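/- For $\zeta>0$ let $K_\pm(\zeta)$ be the integral operators on $L^2(-1,1)$ with the kernels $$k_\pm(x,t,\zeta)=\frac12\left[\frac{\sin \zeta\pi(x-t)}{\pi(x-t)}\pm\frac{\sin \zeta\pi(x+t)}{\pi(x+t)}\right]$$ (where $\frac{\sin\zeta\pi u}{\pi u}$ means $\zeta$ at $u=0$), and let $P_\pm(\zeta,1)=\det(I-K_\pm(\zeta))$ be their Fredholm determinants, i.e. the sums of the Fredholm series $$\sum_{n\ge 0}\frac{(-1)^n}{n!}\int_{[-1,1]^n}\det\big[k_\pm(x_i,x_j,\zeta)\big]_{i,j=1}^n\,dx_1\cdots dx_n .$$ Let $C_\zeta f(x)=\int_{-\zeta}^{\zeta}\frac{\sin\pi(x-y)}{\pi(x-y)}f(y)\,dy$ on $L^2(-\zeta,\zeta)$. Then, for every $\zeta>0$, there is a continuous kernel $Q_\zeta$ on $[-\zeta,\zeta]^2$ such that $f\mapsto f+\int_{-\zeta}^{\zeta}Q_\zeta(\cdot,y)f(y)\,dy$ is the two-sided inverse of $I-C_\zeta$ on $L^2(-\zeta,\zeta)$ (this kernel is unique); put $$r(\zeta)=e^{i\zeta\pi}+\int_{-\zeta}^{\zeta}Q_\zeta(-\zeta,s)\,e^{-is\pi}\,ds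 .$$ Then for every $\zeta>0$ the Fredholm series converge absolutely, $P_\pm(\zeta,1)>0$, the function $r^2$ is integrable on $(0,\zeta)$, the functions $\log P_\pm(\cdot,1)$ are differentiable at $\zeta$, and $$\zeta\frac{d}{d\zeta}\log P_\pm(\zeta,1)=-\left\{\int_0^\zeta|r^2(s)|\,ds\pm\operatorname{Re}\int_0^\zeta r^2(s)\,ds\right\},$$ with the same choice of sign on both sides. -/

import Mathlib

open MeasureTheory Set

noncomputable section

namespace SineDet

/-- The continuous function `u ↦ sin (ζ π u) / (π u)`, with its value `ζ` at `u = 0`. -/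
def sineFun (ζ u : ℝ) : ℝ := ζ * Real.sinc (ζ * Real.pi * u)

theorem sineFun_of_ne_zero (ζ : ℝ) {u : ℝ} (hu : u ≠ 0) :
    sineFun ζ u = Real.sin (ζ * Real.pi * u) / (Real.pi * u) := by
  have hp := Real.pi_ne_zero
  by_cases h : ζ = 0
  · simp [sineFun, h]
  · have h' : ζ * Real.pi * u ≠ 0 := mul_ne_zero (mul_ne_zero h hp) hu
    rw [sineFun, Real.sinc_of_ne_zero h']
    field_simp

theorem sineFun_zero (ζ : ℝ) : sineFun ζ 0 = ζ := by simp [sineFun]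

/-- The kernel `k_±(x,t,ζ)` of `K_±(ζ)`; the sign `±` is the number `ε = ± 1`. -/
def kPM (ε ζ x t : ℝ) : ℝ := (sineFun ζ (x - t) + ε * sineFun ζ (x + t)) / 2

/-- The `n`-th term of the Fredholm series of `det (I - lam K)`, where `K` is the integral operator
on `L²(a,b)` with the continuous kernel `k`. -/
def fredholmTerm (k : ℝ → ℝ → ℝ) (a b lam : ℝ) (n : ℕ) : ℝ :=
  (-lam) ^ n / (n.factorial : ℝ) *
    ∫ x in Set.pi univ (fun _ : Fin n => Icc a b),
      (Matrix.of (fun i j : Fin n => k (x i) (x j))).det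

/-- The Fredholm determinant `det (I - lam K)`, `K` as above. -/
def fredholmDet (k : ℝ → ℝ → ℝ) (a b lam : ℝ) : ℝ := ∑' n : ℕ, fredholmTerm k a b lam n

/-- `P_±(ζ,lam) = det (I - lam K_±(ζ))`, with `K_±(ζ)` on `L²(-1,1)` and `ε = ± 1`. -/
def P (ε ζ lam : ℝ) : ℝ := fredholmDet (kPM ε ζ) (-1) 1 lam

/-- The integral operator on the interval `(-ζ,ζ)` with real kernel `k`. -/
def intOp (ζ : ℝ) (k : ℝ → ℝ → ℝ) (f : ℝ → ℂ) (x : ℝ) : ℂ :=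
  ∫ t in (-ζ)..ζ, (k x t : ℂ) * f t

/-- `q` is the resolvent kernel of the operator `C f (x) = ∫_{-ζ}^{ζ} k (x,t) f (t) dt`:
it is continuous on `[-ζ,ζ]²`, and the operator `f ↦ f + ∫ q (·,t) f (t) dt` is the two-sided
inverse of `I - C` on the complex space `L²(-ζ,ζ)`. -/
def IsResolventKernel (ζ : ℝ) (k q : ℝ → ℝ → ℝ) : Prop :=
  ContinuousOn (fun p : ℝ × ℝ => q p.1 p.2) (Icc (-ζ) ζ ×ˢ Icc (-ζ) ζ) ∧
  ∀ f : ℝ → ℂ, MemLp f 2 (volume.restrict (Ioc (-ζ) ζ)) →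
    ((fun x => (f x + intOp ζ q f x) - intOp ζ k (fun y => f y + intOp ζ q f y) x)
      =ᵐ[volume.restrict (Ioc (-ζ) ζ)] f) ∧
    ((fun x => (f x - intOp ζ k f x) + intOp ζ q (fun y => f y - intOp ζ k f y) x)
      =ᵐ[volume.restrict (Ioc (-ζ) ζ)] f)

/-- The kernel `sin (π (x - t)) / (π (x - t))`. -/
def sineKernel (x t : ℝ) : ℝ := sineFun 1 (x - t)

open Classical in
/-- `Q_ζ (x,t)`, the resolvent kernel of the sine kernel operator on `(-ζ,ζ)` (by continuity it is
determined on `[-ζ,ζ]²`; the values elsewhere play no role). -/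
def Q (ζ : ℝ) : ℝ → ℝ → ℝ :=
  if h : ∃ q : ℝ → ℝ → ℝ, IsResolventKernel ζ sineKernel q then h.choose else 0

/-- `r(ζ) = e^{iζπ} + ∫_{-ζ}^{ζ} Q_ζ(-ζ,s) e^{-isπ} ds`. -/
def r (ζ : ℝ) : ℂ :=
  Complex.exp (Complex.I * ζ * Real.pi) +
    ∫ s in (-ζ)..ζ, (Q ζ (-ζ) s : ℂ) * Complex.exp (-(Complex.I * s * Real.pi))

end SineDet

end

/-! The `ζ`-derivative of `k_±` has rank one: it is `φ(ζx) φ(ζt)`, where `φ` (`trigPM`) is `cos π·`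
for the sign `+` and `sin π·` for the sign `-`. If `w` solves `(I - K_±(ζ)) w = φ(ζ·)`, then
formally `d/dζ log P_± = -B(ζ)` with `B(ζ) = ∫ w(x) φ(ζx) dx` over `[-1,1]`. Since `P_±` is defined
by its series, this is proved on Fredholm minors: `hasDerivAt_fredholmCoeff_succ` differentiates
each term, Hadamard's inequality allows summation, and a telescoping recursion evaluates the sum
(`hasDerivAt_tsum_fredholmCoeff`).

It remains to compute `ζ B(ζ)`. Rescaled to `[-ζ,ζ]`, the kernel no longer depends on `ζ`; only the
interval does. Comparing the solutions for two intervals and using the symmetry of the kernel gives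
`d/dζ (ζ B(ζ)) = 2 w(ζ,1)²` (`mul_pairing_sub`, `hasDerivAt_mul_pairing`), hence `ζ B(ζ) = ∫ 2
w(s,1)² ds` over `[0,ζ]`.

Finally, `r(s)` is the value at `-s` of the solution of the full sine-kernel equation with
right-hand side `e^{-iπx}`. Its even and odd parts are the cosine and sine solutions `w` and `v`, so
`r(s) = w(s,1) + i v(s,1)` (`r_eq`). Thus `|r²| + Re r² = 2w²` and `|r²| - Re r² = 2v²`, which are
the two signs of the formula.

Solvability rests on the fact that the sine kernel does not have the eigenvalue `1`: an
eigenfunction supported in an interval would have a Fourier transform that is both entire and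
supported in a bounded band. Positivity of `P_±` follows from the differential equation `P' = -B P`
with `P = 1` at `ζ = 0`. -/

noncomputable section

namespace SineDet

/-! ### Integral equations of the second kind with continuous kernels -/

section KernelOperator

theorem abs_integral_mul_le {X : Type*} [TopologicalSpace X] [CompactSpace X]
    [MeasurableSpace X] (μ : Measure X) [IsFiniteMeasure μ] (h f : C(X, ℝ)) :
    |∫ t, h t * f t ∂μ| ≤ μ.real univ * ‖h‖ * ‖f‖ := by
  have := norm_integral_le_of_norm_le_const (μ := μ) (f := fun t => h t * f t) (C := ‖h‖ * ‖f‖)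
    (Filter.Eventually.of_forall fun t => by
      rw [norm_mul]
      exact mul_le_mul (h.norm_coe_le_norm t) (f.norm_coe_le_norm t) (norm_nonneg _)
        (norm_nonneg _))
  rw [Real.norm_eq_abs] at this
  linarith

variable {X : Type*} [MetricSpace X] [CompactSpace X] [MeasurableSpace X] [BorelSpace X]
  (μ : Measure X) [IsFiniteMeasure μ]

theorem integrable_of_continuous {f : X → ℝ} (hf : Continuous f) : Integrable f μ :=
  hf.integrable_of_hasCompactSupport (HasCompactSupport.of_compactSpace _)

/-- The integral operator on `C(X, ℝ)` with the continuous kernel `k`. -/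
def kernelMap (k : C(X × X, ℝ)) (f : C(X, ℝ)) : C(X, ℝ) where
  toFun x := ∫ t, k (x, t) * f t ∂μ
  continuous_toFun := by
    have := continuous_parametric_integral_of_continuous (μ := μ)
      (f := fun (x : X) (t : X) => k (x, t) * f t) (by fun_prop) (s := univ) isCompact_univ
    simpa using this

/-- The integral operator on `C(X, ℝ)` as a continuous linear function of its kernel. -/
def kernelOp : C(X × X, ℝ) →L[ℝ] C(X, ℝ) →L[ℝ] C(X, ℝ) :=
  LinearMap.mkContinuous₂
    (LinearMap.mk₂ ℝ (kernelMap μ)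
      (fun k l f => by
        ext x
        simp only [kernelMap, ContinuousMap.coe_mk, ContinuousMap.add_apply, add_mul]
        exact integral_add (integrable_of_continuous μ (by fun_prop))
          (integrable_of_continuous μ (by fun_prop)))
      (fun c k f => by
        ext x
        simp [kernelMap, mul_assoc, integral_const_mul])
      (fun k f g => by
        ext x
        simp only [kernelMap, ContinuousMap.coe_mk, ContinuousMap.add_apply, mul_add]
        exact integral_add (integrable_of_continuous μ (by fun_prop))
          (integrable_of_continuous μ (by fun_prop)))
      (fun c k f => by
        ext x
        simp only [kernelMap, ContinuousMap.coe_mk, ContinuousMap.smul_apply, smul_eq_mul,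
          mul_left_comm _ c, integral_const_mul]))
    (μ.real univ) (fun k f => by
      rw [LinearMap.mk₂_apply, ContinuousMap.norm_le _ (by positivity)]
      intro x
      refine (abs_integral_mul_le μ (k.curry x) f).trans ?_
      gcongr
      rw [ContinuousMap.norm_le _ (by positivity)]
      exact fun t => k.norm_coe_le_norm (x, t))

theorem kernelOp_apply (k : C(X × X, ℝ)) (f : C(X, ℝ)) (x : X) :
    kernelOp μ k f x = ∫ t, k (x, t) * f t ∂μ := rfl

/-- Arzelà–Ascoli: the image of the unit ball is bounded, and it is equicontinuous because `x ↦ k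
(x, ·)` is continuous in the sup norm. -/
theorem isCompactOperator_kernelOp (k : C(X × X, ℝ)) : IsCompactOperator (kernelOp μ k) := by
  let e := ContinuousMap.isometryEquivBoundedOfCompact X ℝ
  let A := e '' (kernelOp μ k '' Metric.closedBall 0 1)
  have hA : IsCompact (closure A) := by
    refine BoundedContinuousFunction.arzela_ascoli
      (Metric.closedBall 0 ‖kernelOp μ k‖) (isCompact_closedBall _ _) A ?_ ?_
    · rintro _ x ⟨_, ⟨f, hf, rfl⟩, rfl⟩
      rw [mem_closedBall_zero_iff] at hf ⊢
      calc ‖kernelOp μ k f x‖ ≤ ‖kernelOp μ k f‖ := ContinuousMap.norm_coe_le_norm _ x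
        _ ≤ ‖kernelOp μ k‖ * ‖f‖ := ContinuousLinearMap.le_opNorm _ _
        _ ≤ _ := mul_le_of_le_one_right (kernelOp μ k).opNorm_nonneg hf
    · intro x₀
      rw [Metric.equicontinuousAt_iff_right]
      intro δ hδ
      have hc : Filter.Tendsto (fun x => μ.real univ * ‖k.curry x₀ - k.curry x‖) (nhds x₀)
          (nhds 0) := by
        have : Continuous (fun x => μ.real univ * ‖k.curry x₀ - k.curry x‖) := by fun_prop
        simpa using this.tendsto x₀
      filter_upwards [hc.eventually (gt_mem_nhds hδ)] with x hx
      rintro ⟨_, _, ⟨f, hf, rfl⟩, rfl⟩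
      rw [mem_closedBall_zero_iff] at hf
      change dist (kernelOp μ k f x₀) (kernelOp μ k f x) < δ
      refine lt_of_le_of_lt ?_ hx
      have h1 : kernelOp μ k f x₀ - kernelOp μ k f x
          = ∫ t, (k.curry x₀ - k.curry x) t * f t ∂μ := by
        simp only [kernelOp_apply, ContinuousMap.sub_apply, ContinuousMap.curry_apply, sub_mul]
        exact (integral_sub (integrable_of_continuous μ (by fun_prop))
          (integrable_of_continuous μ (by fun_prop))).symm
      rw [Real.dist_eq, h1]
      exact (abs_integral_mul_le μ _ f).trans (mul_le_of_le_one_right (by positivity) hf)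
  have h1 : ∃ K, IsCompact K ∧ kernelOp μ k '' Metric.closedBall 0 1 ⊆ K := by
    refine ⟨e.symm '' closure A, hA.image e.symm.continuous, ?_⟩
    intro g hg
    exact ⟨e g, subset_closure ⟨g, hg, rfl⟩, e.symm_apply_apply g⟩
  exact (isCompactOperator_iff_image_closedBall_subset_compact (kernelOp μ k).toLinearMap
    one_pos).2 h1

/-- The Fredholm alternative for a compact operator at the spectral value `1`. -/
theorem isUnit_one_sub_kernelOp (k : C(X × X, ℝ))
    (hk : ∀ f : C(X, ℝ), kernelOp μ k f = f → f = 0) :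
    IsUnit (1 - kernelOp μ k) := by
  rcases (isCompactOperator_kernelOp μ k).hasEigenvalue_or_mem_resolventSet (one_ne_zero (α := ℝ))
    with h | h
  · obtain ⟨f, hf⟩ := h.exists_hasEigenvector
    exact absurd (hk f (by simpa using hf.apply_eq_smul)) hf.2
  · simpa [spectrum.mem_resolventSet_iff] using h

/-- The solution of an integral equation of the second kind depends continuously on the
parameters of the equation. -/
theorem exists_continuous_solution {Z : Type*} [TopologicalSpace Z] (k : C(Z, C(X × X, ℝ)))
    (φ : C(Z, C(X, ℝ))) (hk : ∀ z, ∀ f : C(X, ℝ), kernelOp μ (k z) f = f → f = 0) :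
    ∃ w : C(Z, C(X, ℝ)), ∀ z, w z = φ z + kernelOp μ (k z) (w z) := by
  have hu := fun z => isUnit_one_sub_kernelOp μ (k z) (hk z)
  -- Inversion in a Banach algebra is continuous at units, and the operator depends continuously on
  -- its kernel in norm.
  have hc : Continuous fun z => Ring.inverse (1 - kernelOp μ (k z)) (φ z) := by
    refine Continuous.clm_apply ?_ φ.continuous
    rw [continuous_iff_continuousAt]
    intro z
    obtain ⟨u, hu⟩ := hu z
    have h1 : ContinuousAt Ring.inverse (1 - kernelOp μ (k z)) := by
      rw [← hu]; exact NormedRing.inverse_continuousAt (R := C(X, ℝ) →L[ℝ] C(X, ℝ)) u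
    have h2 : Continuous fun z => 1 - kernelOp μ (k z) := by fun_prop
    exact ContinuousAt.comp (f := fun z => 1 - kernelOp μ (k z)) h1 h2.continuousAt
  refine ⟨⟨_, hc⟩, fun z => ?_⟩
  have h1 := congrArg (fun T : C(X, ℝ) →L[ℝ] C(X, ℝ) => T (φ z)) (Ring.mul_inverse_cancel _ (hu z))
  simp only [mul_apply_eq_comp, sub_apply,
    one_apply_eq_self] at h1
  exact eq_add_of_sub_eq h1

end KernelOperator

/-- Solutions on `ℝ` of an integral equation on `[-L, L]` which depends on a parameter. -/
theorem exists_solution {Z : Type*} [TopologicalSpace Z] [FirstCountableTopology Z]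
    [LocallyCompactSpace Z] {L : ℝ} (hL : 0 < L)
    {k : Z → ℝ → ℝ → ℝ} (hk : Continuous fun p : Z × ℝ × ℝ => k p.1 p.2.1 p.2.2)
    {φ : Z → ℝ → ℝ} (hφ : Continuous fun p : Z × ℝ => φ p.1 p.2)
    (hinj : ∀ z, ∀ f : ℝ → ℝ, Continuous f →
      (∀ x ∈ Icc (-L) L, f x = ∫ t in (-L)..L, k z x t * f t) → ∀ x ∈ Icc (-L) L, f x = 0) :
    ∃ w : Z → ℝ → ℝ, (Continuous fun p : Z × ℝ => w p.1 p.2) ∧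
      ∀ z x, w z x = φ z x + ∫ t in (-L)..L, k z x t * w z t := by
  have hL' : -L ≤ L := by linarith
  let k' : C(Z, C(Icc (-L) L × Icc (-L) L, ℝ)) :=
    (ContinuousMap.mk (fun p : Z × (Icc (-L) L × Icc (-L) L) => k p.1 p.2.1 p.2.2)
      (by fun_prop)).curry
  let φ' : C(Z, C(Icc (-L) L, ℝ)) :=
    (ContinuousMap.mk (fun p : Z × Icc (-L) L => φ p.1 p.2) (by fun_prop)).curry
  let ν : Measure (Icc (-L) L) := (volume : Measure ℝ).comap Subtype.val
  have : IsFiniteMeasure ν := ⟨by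
    rw [(MeasurableEmbedding.subtype_coe measurableSet_Icc).comap_apply]
    rw [image_univ, Subtype.range_coe]
    exact measure_Icc_lt_top⟩
  have key : ∀ z x, ∀ f : C(Icc (-L) L, ℝ),
      ∫ t, k z x t * f t ∂ν = ∫ t in (-L)..L, k z x t * IccExtend hL' f t := by
    intro z x f
    rw [intervalIntegral.integral_of_le hL', ← integral_Icc_eq_integral_Ioc,
      ← integral_subtype_comap measurableSet_Icc]
    simp [ν]
  obtain ⟨w, hw⟩ := exists_continuous_solution ν k' φ' (fun z f hf => by
    have h0 := hinj z (IccExtend hL' f) (f.continuous.Icc_extend') (fun x hx => by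
      rw [← key, IccExtend_of_mem _ _ hx]
      exact (DFunLike.congr_fun hf ⟨x, hx⟩).symm)
    ext x
    simpa using h0 x x.2)
  have hwc : Continuous fun p : Z × ℝ => w p.1 (projIcc (-L) L hL' p.2) := by fun_prop
  let w' : Z → ℝ → ℝ := fun z x =>
    φ z x + ∫ t in (-L)..L, k z x t * w z (projIcc (-L) L hL' t)
  have hw' : ∀ z, ∀ t ∈ Icc (-L) L, w' z t = w z (projIcc (-L) L hL' t) := by
    intro z t ht
    have h1 := DFunLike.congr_fun (hw z) ⟨t, ht⟩
    rw [projIcc_of_mem hL' ht, h1, ContinuousMap.add_apply, kernelOp_apply]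
    change _ = φ z t + ∫ s, k z t s * w z s ∂ν
    rw [key]
    rfl
  refine ⟨w', ?_, fun z x => ?_⟩
  · refine hφ.add ?_
    refine intervalIntegral.continuous_parametric_intervalIntegral_of_continuous'
      (f := fun (p : Z × ℝ) t => k p.1 p.2 t * w p.1 (projIcc (-L) L hL' t)) ?_ _ _
    have h1 : Continuous fun q : (Z × ℝ) × ℝ => k q.1.1 q.1.2 q.2 :=
      hk.comp (by fun_prop : Continuous fun q : (Z × ℝ) × ℝ => (q.1.1, q.1.2, q.2))
    have h2 : Continuous fun q : (Z × ℝ) × ℝ => w q.1.1 (projIcc (-L) L hL' q.2) :=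
      hwc.comp (by fun_prop : Continuous fun q : (Z × ℝ) × ℝ => (q.1.1, q.2))
    exact h1.mul h2
  · change φ z x + _ = _
    congr 1
    refine intervalIntegral.integral_congr fun t ht => ?_
    rw [uIcc_of_le hL'] at ht
    simp only [hw' z t ht]

/-! ### The sine kernel as a function of its parameter -/

section SineFun

theorem continuous_sineFun : Continuous fun p : ℝ × ℝ => sineFun p.1 p.2 := by
  unfold sineFun
  have := Real.continuous_sinc
  fun_prop

theorem abs_sineFun_le (ζ u : ℝ) : |sineFun ζ u| ≤ |ζ| := by
  rw [sineFun, abs_mul]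
  exact mul_le_of_le_one_right (abs_nonneg _) (Real.abs_sinc_le_one _)

theorem sineFun_neg (ζ u : ℝ) : sineFun ζ (-u) = sineFun ζ u := by
  rw [sineFun, sineFun, mul_neg, Real.sinc_neg]

theorem mul_sineFun_one (z u : ℝ) : z * sineFun 1 (z * u) = sineFun z u := by
  rw [sineFun, sineFun]
  ring_nf

theorem hasDerivAt_sineFun (ζ u : ℝ) :
    HasDerivAt (fun z => sineFun z u) (Real.cos (Real.pi * ζ * u)) ζ := by
  rcases eq_or_ne u 0 with rfl | hu
  · simpa [sineFun_zero] using hasDerivAt_id' ζ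
  · have hp := Real.pi_ne_zero
    simp_rw [sineFun_of_ne_zero _ hu]
    have h1 : HasDerivAt (fun z : ℝ => z * Real.pi * u) (Real.pi * u) ζ := by
      simpa using ((hasDerivAt_id' ζ).mul_const Real.pi).mul_const u
    convert! h1.sin.div_const (Real.pi * u) using 1
    rw [mul_div_assoc, div_self (mul_ne_zero hp hu), mul_one, mul_comm ζ]

theorem integral_cos_eq_sineFun (ζ u : ℝ) :
    ∫ s in (0 : ℝ)..ζ, Real.cos (Real.pi * s * u) = sineFun ζ u := by
  rw [intervalIntegral.integral_eq_sub_of_hasDerivAt (fun s _ => hasDerivAt_sineFun s u)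
    (by apply Continuous.intervalIntegrable; fun_prop)]
  simp [sineFun]

end SineFun

theorem integral_integral_swap_of_continuous {F : ℝ → ℝ → ℝ}
    (hF : Continuous fun p : ℝ × ℝ => F p.1 p.2) (a b c d : ℝ) :
    ∫ x in a..b, ∫ y in c..d, F x y = ∫ y in c..d, ∫ x in a..b, F x y := by
  refine intervalIntegral_intervalIntegral_swap ?_
  exact (hF.continuousOn.integrableOn_compact (isCompact_uIcc.prod isCompact_uIcc)).mono_set
    (prod_mono uIoc_subset_uIcc uIoc_subset_uIcc)

theorem eqOn_zero_of_integral_sq_le_zero {p : ℝ → ℝ} (hp : Continuous p) {a b : ℝ} (hab : a < b)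
    (h : ∫ x in a..b, p x ^ 2 ≤ 0) : ∀ x ∈ Icc a b, p x = 0 := by
  intro x hx
  by_contra hne
  have : 0 < ∫ x in a..b, p x ^ 2 :=
    intervalIntegral.integral_pos hab (by fun_prop) (fun _ _ => sq_nonneg _)
      ⟨x, hx, by positivity⟩
  linarith

/-! ### Fourier transforms of functions on a bounded interval, and absence of the eigenvalue `1` -/

section FiniteFourierTransform

/-- The Fourier transform of the restriction of `f` to `[-1, 1]`. -/
def finiteFourier (f : ℝ → ℝ) (z : ℂ) : ℂ :=
  ∫ t in (-1 : ℝ)..1, (f t : ℂ) * Complex.exp (-(Real.pi * z * t * Complex.I))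

variable {f : ℝ → ℝ}

theorem differentiable_finiteFourier (hf : Continuous f) : Differentiable ℂ (finiteFourier f) := by
  intro z₀
  refine (intervalIntegral.hasDerivAt_integral_of_dominated_loc_of_deriv_le
    (F := fun (z : ℂ) (t : ℝ) => (f t : ℂ) * Complex.exp (-(Real.pi * z * t * Complex.I)))
    (F' := fun (z : ℂ) (t : ℝ) => (f t : ℂ) * (Complex.exp (-(Real.pi * z * t * Complex.I)) *
      (-(Real.pi * t * Complex.I))))
    (bound := fun t => |f t| * (Real.exp (Real.pi * (‖z₀‖ + 1)) * Real.pi))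
    (Metric.ball_mem_nhds z₀ one_pos) ?_ ?_ ?_ ?_ ?_ ?_).2.differentiableAt
  · exact Filter.Eventually.of_forall fun z => (by fun_prop : Continuous _).aestronglyMeasurable
  · exact (by fun_prop : Continuous _).intervalIntegrable _ _
  · exact (by fun_prop : Continuous _).aestronglyMeasurable
  · refine Filter.Eventually.of_forall fun t ht z hz => ?_
    rw [uIoc_of_le (by norm_num)] at ht
    have ht' : |t| ≤ 1 := abs_le.2 ⟨ht.1.le, ht.2⟩
    have hz' : ‖z‖ ≤ ‖z₀‖ + 1 := by
      have h1 : ‖z - z₀‖ < 1 := by rwa [← dist_eq_norm]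
      have h2 := norm_le_norm_add_norm_sub' z z₀
      linarith
    have hp := Real.pi_pos
    rw [norm_mul, norm_mul, Complex.norm_real, Real.norm_eq_abs]
    refine mul_le_mul_of_nonneg_left (mul_le_mul ?_ ?_ (norm_nonneg _) (Real.exp_nonneg _))
      (abs_nonneg _)
    · refine (Complex.norm_exp_le_exp_norm _).trans (Real.exp_le_exp.2 ?_)
      simp only [norm_neg, norm_mul, Complex.norm_real, Complex.norm_I, mul_one, Real.norm_eq_abs,
        abs_of_pos hp]
      calc Real.pi * ‖z‖ * |t| ≤ Real.pi * ‖z‖ * 1 := by gcongr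
        _ ≤ _ := by rw [mul_one]; gcongr
    · simp only [norm_neg, norm_mul, Complex.norm_real, Complex.norm_I, mul_one, Real.norm_eq_abs,
        abs_of_pos hp]
      exact mul_le_of_le_one_right hp.le ht'
  · exact (by fun_prop : Continuous _).intervalIntegrable _ _
  · refine Filter.Eventually.of_forall fun t _ z _ => HasDerivAt.const_mul _ ?_
    have h1 : HasDerivAt (fun z : ℂ => -(Real.pi * z * t * Complex.I))
        (-(Real.pi * t * Complex.I)) z := by
      simpa using ((((hasDerivAt_id' z).const_mul (Real.pi : ℂ)).mul_const (t : ℂ)).mul_const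
        Complex.I).fun_neg
    exact h1.cexp

/-- `‖finiteFourier f s‖ ^ 2` for real `s`. -/
def spectralDensity (f : ℝ → ℝ) (s : ℝ) : ℝ :=
  (∫ t in (-1 : ℝ)..1, f t * Real.cos (Real.pi * s * t)) ^ 2 +
    (∫ t in (-1 : ℝ)..1, f t * Real.sin (Real.pi * s * t)) ^ 2

theorem norm_sq_finiteFourier (hf : Continuous f) (s : ℝ) :
    ‖finiteFourier f s‖ ^ 2 = spectralDensity f s := by
  have h1 : finiteFourier f s = ((∫ t in (-1 : ℝ)..1, f t * Real.cos (Real.pi * s * t) : ℝ) : ℂ) +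
      ((-∫ t in (-1 : ℝ)..1, f t * Real.sin (Real.pi * s * t) : ℝ) : ℂ) * Complex.I := by
    rw [Complex.ofReal_neg, neg_mul, ← sub_eq_add_neg, ← intervalIntegral.integral_ofReal,
      ← intervalIntegral.integral_ofReal, ← intervalIntegral.integral_mul_const,
      ← intervalIntegral.integral_sub]
    · refine intervalIntegral.integral_congr fun t _ => ?_
      have : -((Real.pi : ℂ) * s * t * Complex.I) = ((-(Real.pi * s * t) : ℝ) : ℂ) * Complex.I := by
        push_cast; ring
      rw [this, Complex.exp_mul_I, ← Complex.ofReal_cos, ← Complex.ofReal_sin, Real.cos_neg,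
        Real.sin_neg]
      push_cast
      ring
    · exact (by fun_prop : Continuous _).intervalIntegrable _ _
    · exact (by fun_prop : Continuous _).intervalIntegrable _ _
  rw [h1, Complex.sq_norm, Complex.normSq_add_mul_I, spectralDensity, neg_sq]

theorem continuous_spectralDensity (hf : Continuous f) : Continuous (spectralDensity f) := by
  have h1 : Continuous fun s : ℝ => finiteFourier f s :=
    (differentiable_finiteFourier hf).continuous.comp Complex.continuous_ofReal
  have h2 : spectralDensity f = fun s : ℝ => ‖finiteFourier f s‖ ^ 2 :=
    funext fun s => (norm_sq_finiteFourier hf s).symm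
  rw [h2]
  fun_prop

theorem spectralDensity_nonneg (s : ℝ) : 0 ≤ spectralDensity f s := by
  unfold spectralDensity; positivity

theorem spectralDensity_neg (s : ℝ) : spectralDensity f (-s) = spectralDensity f s := by
  simp [spectralDensity]

/-- The sine operator is a band limitation: its kernel is `∫ cos (π s (x - t)) ds` over `[0, ζ]`, so
its quadratic form is the energy of the Fourier transform in that band. -/
theorem integral_spectralDensity (hf : Continuous f) (ζ : ℝ) :
    ∫ s in (0 : ℝ)..ζ, spectralDensity f s =
      ∫ x in (-1 : ℝ)..1, f x * ∫ t in (-1 : ℝ)..1, sineFun ζ (x - t) * f t := by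
  have h1 : ∀ s, spectralDensity f s = ∫ x in (-1 : ℝ)..1, ∫ t in (-1 : ℝ)..1,
      f x * (Real.cos (Real.pi * s * (x - t)) * f t) := by
    intro s
    rw [spectralDensity, sq, sq, ← intervalIntegral.integral_mul_const,
      ← intervalIntegral.integral_mul_const, ← intervalIntegral.integral_add]
    · refine intervalIntegral.integral_congr fun x _ => ?_
      rw [← intervalIntegral.integral_const_mul, ← intervalIntegral.integral_const_mul,
        ← intervalIntegral.integral_add]
      · refine intervalIntegral.integral_congr fun t _ => ?_
        simp only [mul_sub, Real.cos_sub]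
        ring
      · exact (by fun_prop : Continuous _).intervalIntegrable _ _
      · exact (by fun_prop : Continuous _).intervalIntegrable _ _
    · exact (by fun_prop : Continuous _).intervalIntegrable _ _
    · exact (by fun_prop : Continuous _).intervalIntegrable _ _
  simp_rw [h1]
  rw [integral_integral_swap_of_continuous (F := fun s x => ∫ t in (-1 : ℝ)..1,
      f x * (Real.cos (Real.pi * s * (x - t)) * f t))]
  · refine intervalIntegral.integral_congr fun x _ => ?_
    simp only [intervalIntegral.integral_const_mul]
    congr 1
    rw [integral_integral_swap_of_continuous (F := fun s t =>
      Real.cos (Real.pi * s * (x - t)) * f t) (by fun_prop)]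
    refine intervalIntegral.integral_congr fun t _ => ?_
    simp only [intervalIntegral.integral_mul_const, integral_cos_eq_sineFun]
  · exact intervalIntegral.continuous_parametric_intervalIntegral_of_continuous'
      (f := fun (p : ℝ × ℝ) t => f p.2 * (Real.cos (Real.pi * p.1 * (p.2 - t)) * f t))
      (by fun_prop) _ _

/-- Parseval on `[-1, 1]`, whose period `2` makes the integers the sampling frequencies; summing
over a finite set turns it into Bessel's inequality. Integrated over `θ` this replaces Plancherel on
the line. -/
theorem sum_spectralDensity_le (hf : Continuous f) (S : Finset ℤ) (θ : ℝ) :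
    ∑ n ∈ S, spectralDensity f (n + θ) ≤ 2 * ∫ x in (-1 : ℝ)..1, f x ^ 2 := by
  have hab : (-1 : ℝ) < 1 := by norm_num
  -- Modulation shifts the frequencies by `θ`: the `n`-th Fourier coefficient of `g` is half the
  -- transform of `f` at `n + θ`.
  let g : ℝ → ℂ := fun t => (f t : ℂ) * Complex.exp (-(Real.pi * θ * t * Complex.I))
  have hg : Continuous g := by fun_prop
  have hL2 : MemLp g 2 (volume.restrict (Ioc (-1) 1)) := by
    obtain ⟨C, hC⟩ := isCompact_Icc.exists_bound_of_continuousOn (s := Icc (-1 : ℝ) 1)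
      hg.continuousOn
    refine MemLp.of_bound hg.aestronglyMeasurable C ?_
    filter_upwards [ae_restrict_mem measurableSet_Ioc] with t ht
    exact hC t (Ioc_subset_Icc_self ht)
  have h1 := hasSum_sq_fourierCoeffOn hab hL2
  have hng : ∀ t, ‖g t‖ ^ 2 = f t ^ 2 := by
    intro t
    have : -((Real.pi : ℂ) * θ * t * Complex.I) = ((-(Real.pi * θ * t) : ℝ) : ℂ) * Complex.I := by
      push_cast; ring
    simp only [g]
    rw [this, norm_mul, Complex.norm_exp_ofReal_mul_I, mul_one, Complex.norm_real,
      Real.norm_eq_abs, sq_abs]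
  have h2 : ∀ n : ℤ, ‖fourierCoeffOn hab g n‖ ^ 2 = spectralDensity f (n + θ) / 4 := by
    intro n
    have : fourierCoeffOn hab g n = (1 / 2 : ℝ) • finiteFourier f ((n + θ : ℝ) : ℂ) := by
      rw [fourierCoeffOn_eq_integral, finiteFourier]
      congr 1
      · norm_num
      · refine intervalIntegral.integral_congr fun t _ => ?_
        simp only [g, fourier_coe_apply, smul_eq_mul]
        rw [mul_left_comm, ← Complex.exp_add]
        congr 2
        push_cast
        ring
    rw [this, norm_smul, mul_pow, norm_sq_finiteFourier hf]
    norm_num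
    ring
  simp_rw [h2, hng] at h1
  have h3 := sum_le_hasSum S (fun n _ => by
    have := spectralDensity_nonneg (f := f) (n + θ); positivity) h1
  rw [← Finset.sum_div] at h3
  norm_num at h3
  linarith

theorem integral_spectralDensity_le (hf : Continuous f) (N : ℕ) :
    ∫ s in (0 : ℝ)..N, spectralDensity f s ≤ ∫ x in (-1 : ℝ)..1, f x ^ 2 := by
  have hc := continuous_spectralDensity hf
  have hi : ∀ a b, IntervalIntegrable (spectralDensity f) volume a b :=
    fun a b => hc.intervalIntegrable a b
  -- Cut `[-N, N]` into `2N` unit intervals, translate each to `[0, 1]`, and apply the sampled bound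
  -- under the integral over `θ`.
  have h1 : ∫ s in (-N : ℝ)..N, spectralDensity f s ≤ 2 * ∫ x in (-1 : ℝ)..1, f x ^ 2 := by
    have h2 := intervalIntegral.sum_integral_adjacent_intervals (f := spectralDensity f)
      (μ := volume) (a := fun k : ℕ => (k : ℝ) - N) (n := 2 * N) (fun k _ => hi _ _)
    have h3 : ∀ k : ℕ, ∫ s in ((k : ℝ) - N)..((k + 1 : ℕ) : ℝ) - N, spectralDensity f s =
        ∫ θ in (0 : ℝ)..1, spectralDensity f (((k - N : ℤ) : ℝ) + θ) := by
      intro k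
      rw [intervalIntegral.integral_comp_add_left]
      congr 1 <;> push_cast <;> ring
    simp only [h3] at h2
    have e1 : ((0 : ℕ) : ℝ) - N = -N := by simp
    have e2 : ((2 * N : ℕ) : ℝ) - N = N := by push_cast; ring
    rw [e1, e2, ← intervalIntegral.integral_finsetSum
      (fun k _ => (by fun_prop : Continuous _).intervalIntegrable _ _)] at h2
    rw [← h2]
    have h4 : ∀ θ, ∑ k ∈ Finset.range (2 * N), spectralDensity f (((k - N : ℤ) : ℝ) + θ) ≤
        2 * ∫ x in (-1 : ℝ)..1, f x ^ 2 := by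
      intro θ
      refine le_trans (le_of_eq ?_) (sum_spectralDensity_le hf
        ((Finset.range (2 * N)).image fun k : ℕ => (k : ℤ) - N) θ)
      rw [Finset.sum_image]
      intro a _ b _ h
      simpa using h
    calc _ ≤ ∫ θ in (0 : ℝ)..1, (2 * ∫ x in (-1 : ℝ)..1, f x ^ 2) :=
          intervalIntegral.integral_mono (by norm_num)
            ((by fun_prop : Continuous _).intervalIntegrable _ _) (by simp) h4
      _ = _ := by simp
  rw [← intervalIntegral.integral_add_adjacent_intervals (hi _ 0) (hi 0 _)] at h1
  have h2 : ∫ s in (-N : ℝ)..0, spectralDensity f s = ∫ s in (0 : ℝ)..N, spectralDensity f s := by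
    have := intervalIntegral.integral_comp_neg (a := 0) (b := (N : ℝ)) (spectralDensity f)
    simp only [spectralDensity_neg, neg_zero] at this
    exact this.symm
  linarith

end FiniteFourierTransform

/-- The operator with kernel `sin (ζ π (x - t)) / (π (x - t))` on `[-1, 1]` does not have the
eigenvalue `1`. -/
theorem eq_zero_of_eq_integral_sineFun_of_continuous {ζ : ℝ} {f : ℝ → ℝ}
    (hf : Continuous f)
    (h : ∀ x ∈ Icc (-1 : ℝ) 1, f x = ∫ t in (-1 : ℝ)..1, sineFun ζ (x - t) * f t) :
    ∀ x ∈ Icc (-1 : ℝ) 1, f x = 0 := by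
  have hc := continuous_spectralDensity hf
  have hi : ∀ a b, IntervalIntegrable (spectralDensity f) volume a b :=
    fun a b => hc.intervalIntegrable a b
  have h1 : ∫ s in (0 : ℝ)..ζ, spectralDensity f s = ∫ x in (-1 : ℝ)..1, f x ^ 2 := by
    rw [integral_spectralDensity hf]
    refine intervalIntegral.integral_congr fun x hx => ?_
    rw [uIcc_of_le (by norm_num)] at hx
    rw [← h x hx, sq]
  -- For an eigenfunction the band up to `ζ` already carries all the available energy, so nothing is
  -- left beyond `ζ`.
  have h2 : ∀ s, ζ < s → finiteFourier f s = 0 := by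
    intro s hs
    obtain ⟨N, hN⟩ := exists_nat_ge s
    have h3 := integral_spectralDensity_le hf N
    rw [← intervalIntegral.integral_add_adjacent_intervals (hi 0 ζ) (hi ζ N), h1] at h3
    have h4 : spectralDensity f s = 0 := by
      by_contra hne
      have : 0 < ∫ s in ζ..N, spectralDensity f s :=
        intervalIntegral.integral_pos (hs.trans_le hN) hc.continuousOn
          (fun _ _ => spectralDensity_nonneg _)
          ⟨s, ⟨hs.le, hN⟩, lt_of_le_of_ne (spectralDensity_nonneg _) (Ne.symm hne)⟩
      linarith
    rw [← norm_sq_finiteFourier hf] at h4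
    simpa using h4
  have h3 : finiteFourier f = 0 := by
    -- Identity theorem: the transform is entire and its zeros accumulate at `ζ + 1` from the right.
    refine AnalyticOnNhd.eq_of_frequently_eq (z₀ := ((ζ + 1 : ℝ) : ℂ))
      (fun z _ => (differentiable_finiteFourier hf).analyticAt z) (fun z _ => analyticAt_const) ?_
    have h4 : Filter.Tendsto (fun s : ℝ => (s : ℂ)) (nhdsWithin (ζ + 1) (Ioi (ζ + 1)))
        (nhdsWithin ((ζ + 1 : ℝ) : ℂ) {((ζ + 1 : ℝ) : ℂ)}ᶜ) := by
      refine tendsto_nhdsWithin_of_tendsto_nhds_of_eventually_within _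
        (Complex.continuous_ofReal.continuousAt.tendsto.mono_left nhdsWithin_le_nhds) ?_
      filter_upwards [self_mem_nhdsWithin] with s hs
      exact fun h => (ne_of_gt (mem_Ioi.1 hs)) (Complex.ofReal_injective h)
    refine h4.frequently (Filter.Eventually.frequently ?_)
    filter_upwards [self_mem_nhdsWithin] with s hs
    exact h2 s (by have : ζ + 1 < s := hs; linarith)
  refine eqOn_zero_of_integral_sq_le_zero hf (by norm_num) ?_
  rw [← h1]
  have : ∀ s, spectralDensity f s = 0 := fun s => by
    rw [← norm_sq_finiteFourier hf, h3]; simp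
  simp [this]

theorem integral_congr_Icc {a b : ℝ} (hab : a ≤ b) {f g : ℝ → ℝ} (h : ∀ x ∈ Icc a b, f x = g x) :
    ∫ x in a..b, f x = ∫ x in a..b, g x :=
  intervalIntegral.integral_congr fun x hx => h x (by rwa [uIcc_of_le hab] at hx)

theorem eq_zero_of_eq_integral_sineFun {ζ : ℝ} {f : ℝ → ℝ}
    (hf : ContinuousOn f (Icc (-1) 1))
    (h : ∀ x ∈ Icc (-1 : ℝ) 1, f x = ∫ t in (-1 : ℝ)..1, sineFun ζ (x - t) * f t) :
    ∀ x ∈ Icc (-1 : ℝ) 1, f x = 0 := by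
  have h1 : (-1 : ℝ) ≤ 1 := by norm_num
  have h2 : ∀ x ∈ Icc (-1 : ℝ) 1, IccExtend h1 (domRestrict (Icc (-1) 1) f) x = f x :=
    fun x hx => by rw [IccExtend_of_mem _ _ hx, domRestrict_apply]
  intro x hx
  rw [← h2 x hx]
  refine eq_zero_of_eq_integral_sineFun_of_continuous (ζ := ζ) hf.domRestrict.Icc_extend' ?_ x hx
  intro y hy
  rw [h2 y hy, h y hy]
  exact integral_congr_Icc h1 fun t ht => by rw [h2 t ht]

/-- The operator with kernel `sin (π (x - t)) / (π (x - t))` on `[-L, L]` does not have the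
eigenvalue `1`. -/
theorem eq_zero_of_eq_integral_sineKernel {L : ℝ} (hL : 0 < L) {f : ℝ → ℝ}
    (hf : ContinuousOn f (Icc (-L) L))
    (h : ∀ x ∈ Icc (-L) L, f x = ∫ t in (-L)..L, sineKernel x t * f t) :
    ∀ x ∈ Icc (-L) L, f x = 0 := by
  have hm : ∀ y ∈ Icc (-1 : ℝ) 1, L * y ∈ Icc (-L) L := fun y hy =>
    ⟨by nlinarith [hy.1], by nlinarith [hy.2]⟩
  have key : ∀ y ∈ Icc (-1 : ℝ) 1, f (L * y) = 0 := by
    refine eq_zero_of_eq_integral_sineFun (ζ := L)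
      (hf.comp (by fun_prop) hm) fun y hy => ?_
    rw [h _ (hm y hy)]
    have := intervalIntegral.mul_integral_comp_mul_left (a := -1) (b := 1)
      (f := fun t => sineKernel (L * y) t * f t) L
    rw [mul_neg, mul_one] at this
    rw [← this, ← intervalIntegral.integral_const_mul]
    refine intervalIntegral.integral_congr fun t _ => ?_
    simp only [sineKernel]
    rw [← mul_sineFun_one L (y - t), mul_sub, mul_assoc]
  intro x hx
  have := key (x / L) ⟨by rw [le_div_iff₀ hL]; linarith [hx.1], by
    rw [div_le_iff₀ hL]; linarith [hx.2]⟩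
  rwa [mul_div_cancel₀ _ hL.ne'] at this

/-! ### Parity, scaling and the rank-one derivative of the kernels -/

section EvenOdd

variable {ε : ℝ}

theorem continuous_kPM (ε : ℝ) : Continuous fun p : ℝ × ℝ × ℝ => kPM ε p.1 p.2.1 p.2.2 := by
  have h1 : Continuous fun p : ℝ × ℝ × ℝ => sineFun p.1 (p.2.1 - p.2.2) :=
    continuous_sineFun.comp (by fun_prop : Continuous fun p : ℝ × ℝ × ℝ => (p.1, p.2.1 - p.2.2))
  have h2 : Continuous fun p : ℝ × ℝ × ℝ => sineFun p.1 (p.2.1 + p.2.2) :=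
    continuous_sineFun.comp (by fun_prop : Continuous fun p : ℝ × ℝ × ℝ => (p.1, p.2.1 + p.2.2))
  unfold kPM
  fun_prop

theorem kPM_symm (ε z x t : ℝ) : kPM ε z x t = kPM ε z t x := by
  rw [kPM, kPM, ← sineFun_neg z (x - t), neg_sub, add_comm x t]

theorem kPM_neg_left (hε : ε = 1 ∨ ε = -1) (z x t : ℝ) : kPM ε z (-x) t = ε * kPM ε z x t := by
  rw [kPM, kPM, ← sineFun_neg z (-x - t), ← sineFun_neg z (-x + t)]
  rcases hε with rfl | rfl <;> ring_nf

theorem abs_kPM_le (hε : ε = 1 ∨ ε = -1) (z x t : ℝ) : |kPM ε z x t| ≤ |z| := by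
  have h1 := abs_le.1 (abs_sineFun_le z (x - t))
  have h2 := abs_le.1 (abs_sineFun_le z (x + t))
  rw [kPM, abs_le]
  rcases hε with rfl | rfl <;> constructor <;> linarith [h1.1, h1.2, h2.1, h2.2]

theorem mul_kPM_one (ε z x t : ℝ) : z * kPM ε 1 (z * x) (z * t) = kPM ε z x t := by
  rw [kPM, kPM, ← mul_sineFun_one z (x - t), ← mul_sineFun_one z (x + t)]
  ring_nf

/-- On even (odd) functions the operators with kernels `kPM ε z` and `sineFun z (x - t)` agree. -/
theorem integral_kPM_mul (hε : ε = 1 ∨ ε = -1) {z L x : ℝ} (hL : 0 ≤ L) {f : ℝ → ℝ}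
    (hf : ContinuousOn f (Icc (-L) L)) (hfe : ∀ t ∈ Icc (-L) L, f (-t) = ε * f t) :
    ∫ t in (-L)..L, kPM ε z x t * f t = ∫ t in (-L)..L, sineFun z (x - t) * f t := by
  have hL' : -L ≤ L := by linarith
  have hc1 : Continuous fun t => sineFun z (x - t) :=
    continuous_sineFun.comp (by fun_prop : Continuous fun t : ℝ => (z, x - t))
  have hc2 : Continuous fun t => sineFun z (x + t) :=
    continuous_sineFun.comp (by fun_prop : Continuous fun t : ℝ => (z, x + t))
  have hi : ∀ g : ℝ → ℝ, Continuous g →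
      IntervalIntegrable (fun t => g t * f t) volume (-L) L := fun g hg =>
    (hg.continuousOn.mul hf).intervalIntegrable_of_Icc hL'
  have h2 : ∫ t in (-L)..L, sineFun z (x + t) * f t =
      ε * ∫ t in (-L)..L, sineFun z (x - t) * f t := by
    have := intervalIntegral.integral_comp_neg (a := -L) (b := L)
      (fun t => sineFun z (x + t) * f t)
    rw [neg_neg] at this
    rw [← this, ← intervalIntegral.integral_const_mul]
    refine integral_congr_Icc hL' fun t ht => ?_
    rw [hfe t ht, ← sub_eq_add_neg]
    ring
  have h3 : ∫ t in (-L)..L, kPM ε z x t * f t = ((∫ t in (-L)..L, sineFun z (x - t) * f t) +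
      ε * ∫ t in (-L)..L, sineFun z (x + t) * f t) / 2 := by
    rw [← intervalIntegral.integral_const_mul, ← intervalIntegral.integral_add (hi _ hc1)
      ((hi _ hc2).const_mul ε), ← intervalIntegral.integral_div]
    refine intervalIntegral.integral_congr fun t _ => ?_
    simp only [kPM]
    ring
  rw [h3, h2]
  rcases hε with rfl | rfl <;> ring

/-- The equation forces `f` to have the parity `ε`, and on such functions the operator is the sine
operator. -/
theorem eq_zero_of_eq_integral_kPM (hε : ε = 1 ∨ ε = -1) {z : ℝ} {f : ℝ → ℝ}
    (hf : ContinuousOn f (Icc (-1) 1))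
    (h : ∀ x ∈ Icc (-1 : ℝ) 1, f x = ∫ t in (-1 : ℝ)..1, kPM ε z x t * f t) :
    ∀ x ∈ Icc (-1 : ℝ) 1, f x = 0 := by
  refine eq_zero_of_eq_integral_sineFun (ζ := z) hf fun x hx => ?_
  rw [h x hx, integral_kPM_mul hε zero_le_one hf]
  intro t ht
  rw [h t ht, h (-t) ⟨by linarith [ht.2], by linarith [ht.1]⟩,
    ← intervalIntegral.integral_const_mul]
  refine intervalIntegral.integral_congr fun s _ => ?_
  simp only [kPM_neg_left hε, mul_assoc]

/-- The function `cos (π x)` for `ε = 1`, and `sin (π x)` for `ε = -1`. -/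
def trigPM (ε x : ℝ) : ℝ :=
  (1 + ε) / 2 * Real.cos (Real.pi * x) + (1 - ε) / 2 * Real.sin (Real.pi * x)

theorem continuous_trigPM (ε : ℝ) : Continuous (trigPM ε) := by
  unfold trigPM; fun_prop

theorem trigPM_one (x : ℝ) : trigPM 1 x = Real.cos (Real.pi * x) := by
  rw [trigPM]; norm_num

theorem trigPM_neg_one (x : ℝ) : trigPM (-1) x = Real.sin (Real.pi * x) := by
  rw [trigPM]; norm_num

theorem trigPM_neg (hε : ε = 1 ∨ ε = -1) (x : ℝ) : trigPM ε (-x) = ε * trigPM ε x := by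
  rcases hε with rfl | rfl <;> simp [trigPM_one, trigPM_neg_one]

theorem abs_trigPM_le (hε : ε = 1 ∨ ε = -1) (x : ℝ) : |trigPM ε x| ≤ 1 := by
  rcases hε with rfl | rfl
  · rw [trigPM_one]; exact Real.abs_cos_le_one _
  · rw [trigPM_neg_one]; exact Real.abs_sin_le_one _

/-- The derivative is `(cos (a - b) ± cos (a + b)) / 2`, which factors by the product formulas; this
separation of variables drives the whole determinant computation. -/
theorem hasDerivAt_kPM (hε : ε = 1 ∨ ε = -1) (z x t : ℝ) :
    HasDerivAt (fun z => kPM ε z x t) (trigPM ε (z * x) * trigPM ε (z * t)) z := by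
  convert! ((hasDerivAt_sineFun z (x - t)).add
    ((hasDerivAt_sineFun z (x + t)).const_mul ε)).div_const 2 using 1
  rw [mul_sub, mul_add, Real.cos_sub, Real.cos_add]
  rcases hε with rfl | rfl
  · rw [trigPM_one, trigPM_one]; ring_nf
  · rw [trigPM_neg_one, trigPM_neg_one]; ring_nf

end EvenOdd

/-! ### Hadamard's inequality and the convergence it gives -/

section Hadamard

/-- **Hadamard's inequality** for a matrix with bounded entries. -/
theorem abs_det_le_of_abs_le {n : ℕ} (A : Matrix (Fin n) (Fin n) ℝ) {M : ℝ} (hM : 0 ≤ M)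
    (hA : ∀ i j, |A i j| ≤ M) : |A.det| ≤ (√n * M) ^ n := by
  let b := EuclideanSpace.basisFun (Fin n) ℝ
  let v : Fin n → EuclideanSpace ℝ (Fin n) := fun i => WithLp.toLp 2 (A i)
  have : Fact (Module.finrank ℝ (EuclideanSpace ℝ (Fin n)) = n) := ⟨by simp⟩
  -- The determinant is, up to sign, the volume form on the rows, which is at most the product of
  -- their Euclidean norms.
  have h1 : A.det = b.toBasis.det v := by
    rw [Module.Basis.det_apply, ← Matrix.det_transpose]
    congr 1
  have h2 := b.toBasis.orientation.abs_volumeForm_apply_le v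
  rw [Orientation.volumeForm_robust' _ b, ← h1] at h2
  refine h2.trans ?_
  have h3 : ∀ i, ‖v i‖ ≤ √n * M := by
    intro i
    rw [EuclideanSpace.norm_eq, ← Real.sqrt_sq hM, ← Real.sqrt_mul (by positivity)]
    refine Real.sqrt_le_sqrt ?_
    calc ∑ j, ‖v i j‖ ^ 2 ≤ ∑ _j : Fin n, M ^ 2 :=
          Finset.sum_le_sum fun j _ => pow_le_pow_left₀ (norm_nonneg _) (hA i j) 2
      _ = n * M ^ 2 := by simp
  calc ∏ i, ‖v i‖ ≤ ∏ _i : Fin n, (√n * M) :=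
        Finset.prod_le_prod (fun _ _ => norm_nonneg _) fun i _ => h3 i
    _ = _ := by simp

/-- Since `n ^ n ≤ e ^ n * n!`, the square of the term is at most `(e C²)^n / n!`. Splitting this as
`(4 e C²)^n / n!` times `(1/4)^n`, the inequality of arithmetic and geometric means bounds the term
by half the sum of two summable sequences. -/
theorem summable_sqrt_mul_pow_div_factorial (C : ℝ) :
    Summable fun n : ℕ => (√n * C) ^ n / n.factorial := by
  have h1 : Summable fun n : ℕ => ((4 * Real.exp 1 * C ^ 2) ^ n / n.factorial + (1 / 4) ^ n) / 2 :=
    ((Real.summable_pow_div_factorial _).add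
      (summable_geometric_of_lt_one (by norm_num) (by norm_num))).div_const 2
  refine Summable.of_norm_bounded h1 fun n => ?_
  have hf : (0 : ℝ) < n.factorial := by positivity
  have h2 : (n : ℝ) ^ n ≤ Real.exp 1 ^ n * n.factorial := by
    have := Real.pow_div_factorial_le_exp n (by positivity) n
    rwa [div_le_iff₀ hf, ← mul_one (n : ℝ), Real.exp_nat_mul, mul_one] at this
  set a := ‖(√n * C) ^ n / n.factorial‖ with ha
  have h3 : a ^ 2 ≤ (4 * Real.exp 1 * C ^ 2) ^ n / n.factorial * (1 / 4) ^ n := by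
    have e1 : a ^ 2 = (n : ℝ) ^ n * (C ^ 2) ^ n / n.factorial ^ 2 := by
      rw [ha, Real.norm_eq_abs, sq_abs, div_pow, ← pow_mul, mul_comm n 2, pow_mul, mul_pow,
        Real.sq_sqrt (by positivity), mul_pow]
    have e2 : (4 * Real.exp 1 * C ^ 2) ^ n / n.factorial * (1 / 4) ^ n =
        (Real.exp 1 ^ n * n.factorial) * (C ^ 2) ^ n / n.factorial ^ 2 := by
      rw [mul_pow, mul_pow, div_pow, one_pow]
      field_simp
    rw [e1, e2]
    gcongr
  refine abs_le_of_sq_le_sq' ?_ (by positivity) |>.2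
  refine h3.trans ?_
  nlinarith [sq_nonneg ((4 * Real.exp 1 * C ^ 2) ^ n / n.factorial - (1 / 4 : ℝ) ^ n)]

end Hadamard

/-! ### Algebra of Fredholm minors -/

section Matrices

variable (k : ℝ → ℝ → ℝ) (φ : ℝ → ℝ)

/-- The matrix in the Fredholm series of the kernel `k`. -/
def kernelMatrix {n : ℕ} (y : Fin n → ℝ) : Matrix (Fin n) (Fin n) ℝ :=
  Matrix.of fun i j => k (y i) (y j)

/-- The matrix of the kernel `k` with rows at the points `y` and columns at the points `x, y`,
bordered by the row of the values of `φ`. -/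
def borderedMatrix {n : ℕ} (x : ℝ) (y : Fin n → ℝ) : Matrix (Fin (n + 1)) (Fin (n + 1)) ℝ :=
  Matrix.of (Fin.cons (fun j => φ (Fin.cons (α := fun _ => ℝ) x y j))
    fun i j => k (y i) (Fin.cons (α := fun _ => ℝ) x y j))

variable {k φ}

theorem borderedMatrix_zero {n : ℕ} (x : ℝ) (y : Fin n → ℝ) (j : Fin (n + 1)) :
    borderedMatrix k φ x y 0 j = φ (Fin.cons (α := fun _ => ℝ) x y j) := rfl

theorem borderedMatrix_succ {n : ℕ} (x : ℝ) (y : Fin n → ℝ) (i : Fin n) (j : Fin (n + 1)) :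
    borderedMatrix k φ x y i.succ j = k (y i) (Fin.cons (α := fun _ => ℝ) x y j) := rfl

theorem cons_eq_cycleRange {n : ℕ} (y : Fin (n + 1) → ℝ) (i j : Fin (n + 1)) :
    Fin.cons (α := fun _ => ℝ) (y i) (y ∘ i.succAbove) j = y (i.cycleRange.symm j) := by
  refine Fin.cases ?_ (fun j => ?_) j
  · rw [Fin.cons_zero, Fin.cycleRange_symm_zero]
  · rw [Fin.cons_succ, Fin.cycleRange_symm_succ, Function.comp_apply]

/-- Laplace expansion along the column of `x`, the only place where `x` occurs. Moving the column of
`y i` to the front in the `i`-th minor is a cycle whose sign cancels the Laplace sign up to a common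
`-1`. -/
theorem det_borderedMatrix_succ {n : ℕ} (x : ℝ) (y : Fin (n + 1) → ℝ) :
    (borderedMatrix k φ x y).det = φ x * (kernelMatrix k y).det -
      ∑ i, k (y i) x * (borderedMatrix k φ (y i) (y ∘ i.succAbove)).det := by
  rw [Matrix.det_succ_column_zero, Fin.sum_univ_succ, sub_eq_add_neg, ← Finset.sum_neg_distrib]
  congr 1
  · rw [borderedMatrix_zero, Fin.cons_zero, Fin.val_zero, pow_zero, one_mul]
    congr 2
  · refine Finset.sum_congr rfl fun i _ => ?_
    have h1 : borderedMatrix k φ (y i) (y ∘ i.succAbove) =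
        ((borderedMatrix k φ x y).submatrix i.succ.succAbove Fin.succ).submatrix id
          i.cycleRange.symm := by
      ext a b
      rw [Matrix.submatrix_apply, Matrix.submatrix_apply, id]
      refine Fin.cases ?_ (fun a => ?_) a
      · rw [Fin.succ_succAbove_zero, borderedMatrix_zero, borderedMatrix_zero, Fin.cons_succ,
          cons_eq_cycleRange]
      · rw [Fin.succ_succAbove_succ, borderedMatrix_succ, borderedMatrix_succ, Fin.cons_succ,
          cons_eq_cycleRange, Function.comp_apply]
    rw [h1, Matrix.det_permute', Equiv.Perm.sign_symm, Fin.sign_cycleRange, borderedMatrix_succ,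
      Fin.cons_zero, Fin.val_succ]
    push_cast
    ring

/-- The same cycle applied to rows and columns leaves the determinant unchanged and brings the
replaced row to the top. -/
theorem det_updateRow_kernelMatrix {n : ℕ} (y : Fin (n + 1) → ℝ) (i : Fin (n + 1)) :
    ((kernelMatrix k y).updateRow i fun j => φ (y j)).det =
      (borderedMatrix k φ (y i) (y ∘ i.succAbove)).det := by
  have h1 : borderedMatrix k φ (y i) (y ∘ i.succAbove) =
      ((kernelMatrix k y).updateRow i fun j => φ (y j)).submatrix i.cycleRange.symm
        i.cycleRange.symm := by
    ext a b
    rw [Matrix.submatrix_apply]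
    refine Fin.cases ?_ (fun a => ?_) a
    · rw [Fin.cycleRange_symm_zero, Matrix.updateRow_self, borderedMatrix_zero, cons_eq_cycleRange]
    · rw [Fin.cycleRange_symm_succ, Matrix.updateRow_ne (Fin.succAbove_ne i a),
        borderedMatrix_succ, cons_eq_cycleRange]
      rfl
  rw [h1, Matrix.det_submatrix_equiv_self]

theorem hasDerivAt_det {n : ℕ} {A : ℝ → Matrix (Fin n) (Fin n) ℝ} {A' : Matrix (Fin n) (Fin n) ℝ}
    {z : ℝ} (hA : ∀ i j, HasDerivAt (fun z => A z i j) (A' i j) z) :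
    HasDerivAt (fun z => (A z).det) (∑ i, ((A z).updateRow i (A' i)).det) z := by
  let f : ContinuousMultilinearMap ℝ (fun _ : Fin n => Fin n → ℝ) ℝ :=
    ⟨(Matrix.detRowAlternating (n := Fin n) (R := ℝ)).toMultilinearMap, by
      exact Continuous.matrix_det continuous_id⟩
  have h1 : HasDerivAt (fun z => (fun i j => A z i j : Fin n → Fin n → ℝ)) (fun i j => A' i j) z :=
    hasDerivAt_pi.2 fun i => hasDerivAt_pi.2 fun j => hA i j
  have h2 := (f.hasFDerivAt (fun i j => A z i j)).comp_hasDerivAt z h1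
  rw [ContinuousMultilinearMap.linearDeriv_apply] at h2
  exact h2

theorem continuous_det_kernelMatrix (hk : Continuous fun p : ℝ × ℝ => k p.1 p.2) (n : ℕ) :
    Continuous fun y : Fin n → ℝ => (kernelMatrix k y).det := by
  refine Continuous.matrix_det (continuous_matrix fun i j => ?_)
  exact hk.comp (by fun_prop : Continuous fun y : Fin n → ℝ => (y i, y j))

theorem continuous_det_borderedMatrix (hk : Continuous fun p : ℝ × ℝ => k p.1 p.2)
    (hφ : Continuous φ) (n : ℕ) :
    Continuous fun p : ℝ × (Fin n → ℝ) => (borderedMatrix k φ p.1 p.2).det := by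
  have h1 : ∀ j : Fin (n + 1), Continuous fun p : ℝ × (Fin n → ℝ) =>
      Fin.cons (α := fun _ => ℝ) p.1 p.2 j := by
    intro j
    refine Fin.cases ?_ (fun j => ?_) j
    · simpa using continuous_fst
    · simp only [Fin.cons_succ]; fun_prop
  refine Continuous.matrix_det (continuous_matrix fun i j => ?_)
  refine Fin.cases ?_ (fun i => ?_) i
  · exact hφ.comp (h1 j)
  · exact hk.comp (((continuous_apply i).comp continuous_snd).prodMk (h1 j))

variable {M : ℝ}

theorem abs_det_kernelMatrix_le (hM : 0 ≤ M) (hkM : ∀ x t, |k x t| ≤ M) {n : ℕ} (y : Fin n → ℝ) :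
    |(kernelMatrix k y).det| ≤ (√n * M) ^ n :=
  abs_det_le_of_abs_le _ hM fun _ _ => hkM _ _

theorem abs_det_borderedMatrix_le (hM : 0 ≤ M) (hkM : ∀ x t, |k x t| ≤ M) (hφM : ∀ x, |φ x| ≤ M)
    {n : ℕ} (x : ℝ) (y : Fin n → ℝ) :
    |(borderedMatrix k φ x y).det| ≤ (√(n + 1 : ℕ) * M) ^ (n + 1) := by
  refine abs_det_le_of_abs_le _ hM fun i j => ?_
  refine Fin.cases ?_ (fun i => ?_) i
  · exact hφM _
  · exact hkM _ _

end Matrices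

/-! ### Integrated minors and the telescoping of the differentiated series -/

section FredholmSeries

variable (μ : Measure ℝ) {k : ℝ → ℝ → ℝ} {φ : ℝ → ℝ} {M : ℝ}

/-- The integral of the determinant of `kernelMatrix k`. -/
def fredholmCoeff (k : ℝ → ℝ → ℝ) (n : ℕ) : ℝ :=
  ∫ y, (kernelMatrix k y).det ∂(Measure.pi fun _ : Fin n => μ)

/-- The integral of the determinant of `borderedMatrix k φ`. -/
def borderedCoeff (k : ℝ → ℝ → ℝ) (φ : ℝ → ℝ) (n : ℕ) (x : ℝ) : ℝ :=
  ∫ y, (borderedMatrix k φ x y).det ∂(Measure.pi fun _ : Fin n => μ)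

theorem fredholmCoeff_zero : fredholmCoeff μ k 0 = 1 := by
  simp [fredholmCoeff, measureReal_def]

theorem borderedCoeff_zero (x : ℝ) : borderedCoeff μ k φ 0 x = φ x := by
  simp [borderedCoeff, borderedMatrix_zero, measureReal_def]

variable [IsFiniteMeasure μ]

theorem integral_pi_eq_succAbove {n : ℕ} (i : Fin (n + 1)) {G : ℝ → (Fin n → ℝ) → ℝ} {C : ℝ}
    (hG : Continuous fun p : ℝ × (Fin n → ℝ) => G p.1 p.2) (hC : ∀ t y, |G t y| ≤ C) :
    ∫ y, G (y i) (y ∘ i.succAbove) ∂(Measure.pi fun _ : Fin (n + 1) => μ) =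
      ∫ t, ∫ y, G t y ∂(Measure.pi fun _ : Fin n => μ) ∂μ := by
  have h1 := (measurePreserving_piFinSuccAbove (fun _ : Fin (n + 1) => μ) i).integral_comp'
    (fun p : ℝ × (Fin n → ℝ) => G p.1 p.2)
  rw [integral_prod] at h1
  · exact h1
  · exact Integrable.of_bound hG.aestronglyMeasurable C (Filter.Eventually.of_forall fun p => hC _ _)

theorem abs_fredholmCoeff_le (hM : 0 ≤ M) (hkM : ∀ x t, |k x t| ≤ M) (n : ℕ) :
    |fredholmCoeff μ k n| ≤ (√n * (M * μ.real univ)) ^ n := by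
  refine (norm_integral_le_of_norm_le_const (f := fun y => (kernelMatrix k y).det)
    (Filter.Eventually.of_forall fun y => abs_det_kernelMatrix_le hM hkM y)).trans (le_of_eq ?_)
  rw [Measure.real, Measure.pi_univ, Finset.prod_const, Finset.card_univ, Fintype.card_fin,
    ENNReal.toReal_pow, ← mul_assoc, mul_pow (√n * M)]
  rfl

theorem abs_borderedCoeff_le (hM : 0 ≤ M) (hkM : ∀ x t, |k x t| ≤ M) (hφM : ∀ x, |φ x| ≤ M)
    (n : ℕ) (x : ℝ) :
    |borderedCoeff μ k φ n x| ≤ (√(n + 1 : ℕ) * M) ^ (n + 1) * μ.real univ ^ n := by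
  refine (norm_integral_le_of_norm_le_const (f := fun y => (borderedMatrix k φ x y).det)
    (Filter.Eventually.of_forall fun y =>
      abs_det_borderedMatrix_le hM hkM hφM x y)).trans (le_of_eq ?_)
  rw [Measure.real, Measure.pi_univ, Finset.prod_const, Finset.card_univ, Fintype.card_fin,
    ENNReal.toReal_pow]
  rfl

theorem aestronglyMeasurable_borderedCoeff (hk : Continuous fun p : ℝ × ℝ => k p.1 p.2)
    (hφ : Continuous φ) (n : ℕ) : AEStronglyMeasurable (borderedCoeff μ k φ n) μ :=
  ((continuous_det_borderedMatrix hk hφ n).stronglyMeasurable.integral_prod_right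
    (ν := Measure.pi fun _ : Fin n => μ)).aestronglyMeasurable

theorem integrable_borderedCoeff (hk : Continuous fun p : ℝ × ℝ => k p.1 p.2)
    (hφ : Continuous φ) (hM : 0 ≤ M) (hkM : ∀ x t, |k x t| ≤ M) (hφM : ∀ x, |φ x| ≤ M) (n : ℕ) :
    Integrable (borderedCoeff μ k φ n) μ :=
  Integrable.of_bound (aestronglyMeasurable_borderedCoeff μ hk hφ n) _
    (Filter.Eventually.of_forall fun x => abs_borderedCoeff_le μ hM hkM hφM n x)

/-- Integrate the Laplace expansion; by Fubini and relabelling of variables all `n + 1` minors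
contribute equally. This is Fredholm's recursion, with the transposed kernel acting on the previous
coefficient. -/
theorem borderedCoeff_succ (hk : Continuous fun p : ℝ × ℝ => k p.1 p.2)
    (hφ : Continuous φ) (hM : 0 ≤ M) (hkM : ∀ x t, |k x t| ≤ M) (hφM : ∀ x, |φ x| ≤ M)
    (n : ℕ) (x : ℝ) :
    borderedCoeff μ k φ (n + 1) x = φ x * fredholmCoeff μ k (n + 1) -
      (n + 1) * ∫ t, k t x * borderedCoeff μ k φ n t ∂μ := by
  have hc : Continuous fun p : ℝ × (Fin n → ℝ) => k p.1 x * (borderedMatrix k φ p.1 p.2).det :=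
    (hk.comp (by fun_prop : Continuous fun p : ℝ × (Fin n → ℝ) => (p.1, x))).mul
      (continuous_det_borderedMatrix hk hφ n)
  have hb : ∀ t (y : Fin n → ℝ), |k t x * (borderedMatrix k φ t y).det| ≤
      M * (√(n + 1 : ℕ) * M) ^ (n + 1) := by
    intro t y
    rw [abs_mul]
    exact mul_le_mul (hkM _ _) (abs_det_borderedMatrix_le hM hkM hφM t y) (abs_nonneg _) hM
  have hi : ∀ i : Fin (n + 1), Integrable (fun y : Fin (n + 1) → ℝ =>
      k (y i) x * (borderedMatrix k φ (y i) (y ∘ i.succAbove)).det)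
      (Measure.pi fun _ : Fin (n + 1) => μ) := fun i =>
    Integrable.of_bound (hc.comp (by fun_prop : Continuous fun y : Fin (n + 1) → ℝ =>
      (y i, y ∘ i.succAbove))).aestronglyMeasurable _ (Filter.Eventually.of_forall fun y => hb _ _)
  rw [borderedCoeff, fredholmCoeff]
  simp_rw [det_borderedMatrix_succ]
  rw [integral_sub, integral_const_mul, integral_finsetSum _ fun i _ => hi i]
  · congr 1
    have : ∀ i : Fin (n + 1), ∫ y : Fin (n + 1) → ℝ,
        k (y i) x * (borderedMatrix k φ (y i) (y ∘ i.succAbove)).det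
          ∂(Measure.pi fun _ : Fin (n + 1) => μ) = ∫ t, k t x * borderedCoeff μ k φ n t ∂μ := by
      intro i
      rw [integral_pi_eq_succAbove μ i
        (G := fun t y => k t x * (borderedMatrix k φ t y).det) hc hb]
      simp_rw [integral_const_mul]
      rfl
    simp_rw [this]
    simp
  · refine Integrable.const_mul ?_ _
    exact Integrable.of_bound (continuous_det_kernelMatrix hk (n + 1)).aestronglyMeasurable _
      (Filter.Eventually.of_forall fun y => abs_det_kernelMatrix_le hM hkM y)
  · exact integrable_finsetSum _ fun i _ => hi i

/-- Pair the recursion with `w` and move the transposed operator onto `w`, where the integral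
equation replaces `K w` by `w - φ`. -/
theorem succ_mul_integral_mul_borderedCoeff (hk : Continuous fun p : ℝ × ℝ => k p.1 p.2)
    (hφ : Continuous φ) (hM : 0 ≤ M) (hkM : ∀ x t, |k x t| ≤ M) (hφM : ∀ x, |φ x| ≤ M)
    {w : ℝ → ℝ} (hw : Integrable w μ) (hwφ : ∀ x, w x = φ x + ∫ t, k x t * w t ∂μ) (n : ℕ) :
    (n + 1) * ∫ x, φ x * borderedCoeff μ k φ n x ∂μ =
      (n + 1) * (∫ x, w x * borderedCoeff μ k φ n x ∂μ)
        - (∫ x, w x * φ x ∂μ) * fredholmCoeff μ k (n + 1)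
        + ∫ x, w x * borderedCoeff μ k φ (n + 1) x ∂μ := by
  have hW := integrable_borderedCoeff μ hk hφ hM hkM hφM
  have hwW : ∀ n, Integrable (fun x => w x * borderedCoeff μ k φ n x) μ := fun n =>
    hw.mul_bdd (aestronglyMeasurable_borderedCoeff μ hk hφ n)
      (Filter.Eventually.of_forall fun x => abs_borderedCoeff_le μ hM hkM hφM n x)
  have hwφi : Integrable (fun x => w x * φ x) μ :=
    hw.mul_bdd hφ.aestronglyMeasurable (Filter.Eventually.of_forall hφM)
  have hφW : Integrable (fun x => φ x * borderedCoeff μ k φ n x) μ :=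
    (hW n).bdd_mul hφ.aestronglyMeasurable (Filter.Eventually.of_forall hφM)
  have h2 : Integrable (Function.uncurry fun x t => k x t * w t * borderedCoeff μ k φ n x)
      (μ.prod μ) := by
    have := ((hW n).mul_prod hw).bdd_mul (c := M) hk.aestronglyMeasurable
      (Filter.Eventually.of_forall fun p => hkM _ _)
    refine this.congr (Filter.Eventually.of_forall fun p => ?_)
    simp only [Function.uncurry]
    ring
  have h3 : ∫ x, (w x - φ x) * borderedCoeff μ k φ n x ∂μ =
      ∫ t, w t * ∫ x, k x t * borderedCoeff μ k φ n x ∂μ ∂μ := by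
    have e1 : ∀ x, (w x - φ x) * borderedCoeff μ k φ n x =
        ∫ t, k x t * w t * borderedCoeff μ k φ n x ∂μ := by
      intro x
      rw [integral_mul_const, hwφ x, add_sub_cancel_left]
    simp_rw [e1]
    rw [integral_integral_swap h2]
    refine integral_congr_ae (Filter.Eventually.of_forall fun t => ?_)
    simp only
    rw [← integral_const_mul]
    refine integral_congr_ae (Filter.Eventually.of_forall fun x => ?_)
    simp only
    ring
  have h4 : (n + 1) * ∫ t, w t * ∫ x, k x t * borderedCoeff μ k φ n x ∂μ ∂μ =
      (∫ x, w x * φ x ∂μ) * fredholmCoeff μ k (n + 1)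
        - ∫ x, w x * borderedCoeff μ k φ (n + 1) x ∂μ := by
    rw [← integral_mul_const, ← integral_const_mul, ← integral_sub (hwφi.mul_const _) (hwW _)]
    refine integral_congr_ae (Filter.Eventually.of_forall fun t => ?_)
    simp only
    rw [borderedCoeff_succ μ hk hφ hM hkM hφM]
    ring
  have h5 : ∫ x, (w x - φ x) * borderedCoeff μ k φ n x ∂μ =
      (∫ x, w x * borderedCoeff μ k φ n x ∂μ) - ∫ x, φ x * borderedCoeff μ k φ n x ∂μ := by
    rw [← integral_sub (hwW n) hφW]
    simp only [sub_mul]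
  have h6 := h3.symm.trans h5
  rw [h6] at h4
  linarith

/-- The sign and the factorial in the `n`-th term of the Fredholm series. -/
def altFactorial (n : ℕ) : ℝ := (-1) ^ n / n.factorial

theorem altFactorial_succ (n : ℕ) : altFactorial (n + 1) * (n + 1) = -altFactorial n := by
  have : (n.factorial : ℝ) ≠ 0 := by positivity
  have : (n + 1 : ℝ) ≠ 0 := by positivity
  rw [altFactorial, altFactorial, Nat.factorial_succ]
  push_cast
  field_simp
  ring

theorem abs_altFactorial (n : ℕ) : |altFactorial n| = 1 / n.factorial := by
  rw [altFactorial, abs_div, abs_pow, abs_neg, abs_one, one_pow, Nat.abs_cast]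

theorem summable_altFactorial_mul_fredholmCoeff (hM : 0 ≤ M) (hkM : ∀ x t, |k x t| ≤ M) :
    Summable fun n => altFactorial n * fredholmCoeff μ k n := by
  refine Summable.of_norm_bounded (summable_sqrt_mul_pow_div_factorial (M * μ.real univ))
    fun n => ?_
  rw [Real.norm_eq_abs, abs_mul, abs_altFactorial, one_div_mul_eq_div]
  gcongr
  exact abs_fredholmCoeff_le μ hM hkM n

/-- A summable bound for the terms with bordered determinants in the Fredholm series. -/
def borderedBound (M m : ℝ) (n : ℕ) : ℝ :=
  (√(n + 1 : ℕ) * M) ^ (n + 1) * m ^ n / n.factorial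

theorem summable_borderedBound {M m : ℝ} (hM : 0 ≤ M) (hm : 0 ≤ m) :
    Summable (borderedBound M m) := by
  -- In the constant `2 * M * (m + 1)`, the power of `2` absorbs the factor `n + 1` between the two
  -- factorials, and `m + 1 ≥ 1` lets the exponent of `m` be raised from `n` to `n + 1`.
  have h1 := (summable_nat_add_iff 1).2 (summable_sqrt_mul_pow_div_factorial (2 * M * (m + 1)))
  refine Summable.of_nonneg_of_le (fun n => ?_) (fun n => ?_) h1
  · unfold borderedBound; positivity
  · have h2 : ((n + 1 : ℕ) : ℝ) ≤ 2 ^ (n + 1) := by exact_mod_cast Nat.lt_two_pow_self.le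
    have h3 : m ^ n ≤ (m + 1) ^ (n + 1) :=
      (pow_le_pow_left₀ hm (by linarith) n).trans
        (pow_le_pow_right₀ (by linarith) (Nat.le_succ n))
    have h4 : (n.factorial : ℝ) ≠ 0 := by positivity
    have h5 : borderedBound M m n = (√(n + 1 : ℕ) * M) ^ (n + 1) * m ^ n * (n + 1 : ℕ) /
        (n + 1).factorial := by
      rw [borderedBound, Nat.factorial_succ]
      push_cast
      field_simp
    rw [h5, show √(n + 1 : ℕ) * (2 * M * (m + 1)) = (√(n + 1 : ℕ) * M) * (m + 1) * 2 by ring,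
      mul_pow _ 2, mul_pow _ (m + 1)]
    gcongr

/-- The sum of the derivatives of the terms of the Fredholm series. -/
theorem tsum_altFactorial_mul_integral_borderedCoeff
    (hk : Continuous fun p : ℝ × ℝ => k p.1 p.2)
    (hφ : Continuous φ) (hM : 0 ≤ M) (hkM : ∀ x t, |k x t| ≤ M) (hφM : ∀ x, |φ x| ≤ M)
    {w : ℝ → ℝ} (hw : Integrable w μ) (hwφ : ∀ x, w x = φ x + ∫ t, k x t * w t ∂μ) :
    ∑' n : ℕ, altFactorial (n + 1) * ((n + 1) * ∫ x, φ x * borderedCoeff μ k φ n x ∂μ) =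
      -(∫ x, w x * φ x ∂μ) * ∑' n : ℕ, altFactorial n * fredholmCoeff μ k n := by
  set A : ℕ → ℝ := fun n => ∫ x, w x * borderedCoeff μ k φ n x ∂μ with hA
  set B := ∫ x, w x * φ x ∂μ with hB
  have hD := summable_altFactorial_mul_fredholmCoeff μ hM hkM
  have hAs : Summable fun n => altFactorial n * A n := by
    refine Summable.of_norm_bounded ((summable_borderedBound hM
      (measureReal_nonneg (μ := μ) (s := univ))).mul_right (∫ x, ‖w x‖ ∂μ)) fun n => ?_
    have h1 : |A n| ≤ (∫ x, ‖w x‖ ∂μ) * ((√(n + 1 : ℕ) * M) ^ (n + 1) * μ.real univ ^ n) := by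
      rw [← integral_mul_const]
      refine norm_integral_le_of_norm_le (f := fun x => w x * borderedCoeff μ k φ n x)
        (hw.norm.mul_const _)
        (Filter.Eventually.of_forall fun x => ?_)
      rw [norm_mul]
      exact mul_le_mul_of_nonneg_left (abs_borderedCoeff_le μ hM hkM hφM n x) (norm_nonneg _)
    rw [Real.norm_eq_abs, abs_mul, abs_altFactorial, borderedBound, one_div_mul_eq_div,
      div_mul_eq_mul_div, mul_comm _ (∫ x, ‖w x‖ ∂μ)]
    gcongr
  -- The differences telescope to `-A 0 = -B`. This supplies the missing zeroth term of the Fredholm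
  -- series multiplied by `-B`.
  have h1 : ∀ n : ℕ, altFactorial (n + 1) * ((n + 1) * ∫ x, φ x * borderedCoeff μ k φ n x ∂μ) =
      (altFactorial (n + 1) * A (n + 1) - altFactorial n * A n) -
        B * (altFactorial (n + 1) * fredholmCoeff μ k (n + 1)) := by
    intro n
    rw [succ_mul_integral_mul_borderedCoeff μ hk hφ hM hkM hφM hw hwφ n]
    have := altFactorial_succ n
    linear_combination (∫ x, w x * borderedCoeff μ k φ n x ∂μ) * this
  have hA1 := (summable_nat_add_iff 1).2 hAs
  have hD1 := (summable_nat_add_iff 1).2 hD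
  simp_rw [h1]
  rw [(hA1.sub hAs).tsum_sub (hD1.mul_left B), hA1.tsum_sub hAs, tsum_mul_left,
    hAs.tsum_eq_zero_add, hD.tsum_eq_zero_add, fredholmCoeff_zero]
  have e1 : A 0 = B := by simp only [hA, borderedCoeff_zero, hB]
  rw [e1]
  simp [altFactorial]
  ring

end FredholmSeries

/-! ### Differentiating the Fredholm determinant in the parameter -/

section Derivative

variable (μ : Measure ℝ) [IsFiniteMeasure μ] {k : ℝ → ℝ → ℝ → ℝ} {φ : ℝ → ℝ → ℝ} {M ζ : ℝ}

/-- The derivative of a determinant replaces one row at a time. The new `i`-th row is `φ (y i)`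
times the row of the values `φ (y j)`, so each term is a bordered minor, and all `n + 1` terms have
the same integral. -/
theorem hasDerivAt_fredholmCoeff_succ
    (hk : ∀ z, Continuous fun p : ℝ × ℝ => k z p.1 p.2) (hφ : ∀ z, Continuous (φ z)) (hM : 0 ≤ M)
    (hkM : ∀ z ∈ Metric.ball ζ 1, ∀ x t, |k z x t| ≤ M)
    (hφM : ∀ z ∈ Metric.ball ζ 1, ∀ x, |φ z x| ≤ M)
    (hd : ∀ z x t, HasDerivAt (fun z => k z x t) (φ z x * φ z t) z)
    {z : ℝ} (hz : z ∈ Metric.ball ζ 1) (n : ℕ) :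
    HasDerivAt (fun z => fredholmCoeff μ (k z) (n + 1))
      ((n + 1) * ∫ x, φ z x * borderedCoeff μ (k z) (φ z) n x ∂μ) z := by
  have hb : ∀ z ∈ Metric.ball ζ 1, ∀ t (y : Fin n → ℝ),
      |φ z t * (borderedMatrix (k z) (φ z) t y).det| ≤ M * (√(n + 1 : ℕ) * M) ^ (n + 1) := by
    intro z hz t y
    rw [abs_mul]
    exact mul_le_mul (hφM z hz _) (abs_det_borderedMatrix_le hM (hkM z hz) (hφM z hz) t y)
      (abs_nonneg _) hM
  have hc : ∀ z, Continuous fun p : ℝ × (Fin n → ℝ) =>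
      φ z p.1 * (borderedMatrix (k z) (φ z) p.1 p.2).det := fun z =>
    ((hφ z).comp continuous_fst).mul (continuous_det_borderedMatrix (hk z) (hφ z) n)
  have hci : ∀ z (i : Fin (n + 1)), Continuous fun y : Fin (n + 1) → ℝ =>
      φ z (y i) * (borderedMatrix (k z) (φ z) (y i) (y ∘ i.succAbove)).det := fun z i =>
    (hc z).comp (by fun_prop : Continuous fun y : Fin (n + 1) → ℝ => (y i, y ∘ i.succAbove))
  have h1 := (hasDerivAt_integral_of_dominated_loc_of_deriv_le
    (μ := Measure.pi fun _ : Fin (n + 1) => μ) (x₀ := z) (s := Metric.ball ζ 1)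
    (F := fun z y => (kernelMatrix (k z) y).det)
    (F' := fun z y => ∑ i, φ z (y i) * (borderedMatrix (k z) (φ z) (y i) (y ∘ i.succAbove)).det)
    (bound := fun _ => ∑ _i : Fin (n + 1), M * (√(n + 1 : ℕ) * M) ^ (n + 1))
    (Metric.isOpen_ball.mem_nhds hz) ?_ ?_ ?_ ?_ ?_ ?_).2
  · convert! h1 using 1
    rw [integral_finsetSum _ fun i _ => Integrable.of_bound (hci z i).aestronglyMeasurable _
      (Filter.Eventually.of_forall fun y => hb z hz _ _)]
    have : ∀ i : Fin (n + 1), ∫ y : Fin (n + 1) → ℝ,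
        φ z (y i) * (borderedMatrix (k z) (φ z) (y i) (y ∘ i.succAbove)).det
          ∂(Measure.pi fun _ : Fin (n + 1) => μ) =
        ∫ t, φ z t * borderedCoeff μ (k z) (φ z) n t ∂μ := by
      intro i
      rw [integral_pi_eq_succAbove μ i
        (G := fun t y => φ z t * (borderedMatrix (k z) (φ z) t y).det) (hc z) (hb z hz)]
      simp_rw [integral_const_mul]
      rfl
    simp_rw [this]
    simp
  · exact Filter.Eventually.of_forall fun z =>
      (continuous_det_kernelMatrix (hk z) (n + 1)).aestronglyMeasurable
  · exact Integrable.of_bound (continuous_det_kernelMatrix (hk z) (n + 1)).aestronglyMeasurable _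
      (Filter.Eventually.of_forall fun y => abs_det_kernelMatrix_le hM (hkM z hz) y)
  · exact (continuous_finsetSum _ fun i _ => hci z i).aestronglyMeasurable
  · refine Filter.Eventually.of_forall fun y z hz => ?_
    exact (Finset.abs_sum_le_sum_abs _ _).trans (Finset.sum_le_sum fun i _ => hb z hz _ _)
  · exact integrable_const _
  · refine Filter.Eventually.of_forall fun y z _ => ?_
    convert! hasDerivAt_det (A := fun z => kernelMatrix (k z) y) (z := z)
      (A' := Matrix.of fun i j => φ z (y i) * φ z (y j)) fun i j => hd z (y i) (y j) using 1
    refine Finset.sum_congr rfl fun i _ => ?_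
    rw [← det_updateRow_kernelMatrix, ← Matrix.det_updateRow_smul]
    rfl

/-- The derivative of a Fredholm determinant in a parameter such that the derivative of
the kernel has rank one. -/
theorem hasDerivAt_tsum_fredholmCoeff
    (hk : ∀ z, Continuous fun p : ℝ × ℝ => k z p.1 p.2) (hφ : ∀ z, Continuous (φ z)) (hM : 0 ≤ M)
    (hkM : ∀ z ∈ Metric.ball ζ 1, ∀ x t, |k z x t| ≤ M)
    (hφM : ∀ z ∈ Metric.ball ζ 1, ∀ x, |φ z x| ≤ M)
    (hd : ∀ z x t, HasDerivAt (fun z => k z x t) (φ z x * φ z t) z)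
    {w : ℝ → ℝ} (hw : Integrable w μ)
    (hwφ : ∀ x, w x = φ ζ x + ∫ t, k ζ x t * w t ∂μ) :
    HasDerivAt (fun z => ∑' n, altFactorial n * fredholmCoeff μ (k z) n)
      (-(∫ x, w x * φ ζ x ∂μ) * ∑' n, altFactorial n * fredholmCoeff μ (k ζ) n) ζ := by
  have hζ : ζ ∈ Metric.ball ζ 1 := Metric.mem_ball_self one_pos
  have h0 : ∀ z ∈ Metric.ball ζ 1, ∑' n, altFactorial n * fredholmCoeff μ (k z) n =
      1 + ∑' n, altFactorial (n + 1) * fredholmCoeff μ (k z) (n + 1) := by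
    intro z hz
    rw [(summable_altFactorial_mul_fredholmCoeff μ hM (hkM z hz)).tsum_eq_zero_add,
      fredholmCoeff_zero]
    simp [altFactorial]
  have h1 : HasDerivAt (fun z => ∑' n, altFactorial (n + 1) * fredholmCoeff μ (k z) (n + 1))
      (∑' n : ℕ, altFactorial (n + 1) *
        ((n + 1) * ∫ x, φ ζ x * borderedCoeff μ (k ζ) (φ ζ) n x ∂μ)) ζ := by
    refine hasDerivAt_tsum_of_isPreconnected
      (g' := fun (n : ℕ) z => altFactorial (n + 1) *
        ((n + 1) * ∫ x, φ z x * borderedCoeff μ (k z) (φ z) n x ∂μ))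
      ((summable_borderedBound hM (measureReal_nonneg (μ := μ) (s := univ))).mul_right
        (M * μ.real univ)) Metric.isOpen_ball (convex_ball ζ 1).isPreconnected ?_ ?_ hζ ?_ hζ
    · exact fun n z hz =>
        (hasDerivAt_fredholmCoeff_succ μ hk hφ hM hkM hφM hd hz n).const_mul _
    · intro n z hz
      have h2 : |∫ x, φ z x * borderedCoeff μ (k z) (φ z) n x ∂μ| ≤
          M * ((√(n + 1 : ℕ) * M) ^ (n + 1) * μ.real univ ^ n) * μ.real univ := by
        refine norm_integral_le_of_norm_le_const
          (f := fun x => φ z x * borderedCoeff μ (k z) (φ z) n x)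
          (Filter.Eventually.of_forall fun x => ?_)
        rw [norm_mul]
        exact mul_le_mul (hφM z hz x) (abs_borderedCoeff_le μ hM (hkM z hz) (hφM z hz) n x)
          (norm_nonneg _) hM
      rw [← mul_assoc, altFactorial_succ, Real.norm_eq_abs, abs_mul, abs_neg, abs_altFactorial,
        borderedBound, one_div_mul_eq_div, div_mul_eq_mul_div]
      gcongr
      linarith
    · exact (summable_nat_add_iff 1).2 (summable_altFactorial_mul_fredholmCoeff μ hM (hkM ζ hζ))
  rw [tsum_altFactorial_mul_integral_borderedCoeff μ (hk ζ) (hφ ζ) hM (hkM ζ hζ) (hφM ζ hζ) hw hwφ]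
    at h1
  refine (h1.const_add 1).congr_of_eventuallyEq ?_
  filter_upwards [Metric.isOpen_ball.mem_nhds hζ] with z hz using h0 z hz

end Derivative

/-! ### Construction and use of resolvent kernels -/

section Resolvent

variable {L : ℝ}

theorem integrable_mul_of_continuous {F : ℝ × ℝ → ℝ} (hF : Continuous F) {f : ℝ → ℂ}
    (hf : Integrable f (volume.restrict (Ioc (-L) L))) :
    Integrable (fun p : ℝ × ℝ => (F p : ℂ) * f p.2)
      ((volume.restrict (Ioc (-L) L)).prod (volume.restrict (Ioc (-L) L))) := by
  obtain ⟨C, hC⟩ := (isCompact_Icc.prod isCompact_Icc).exists_bound_of_continuousOn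
    (s := Icc (-L) L ×ˢ Icc (-L) L) hF.continuousOn
  refine (hf.comp_snd _).bdd_mul (c := C)
    (Complex.continuous_ofReal.comp hF).aestronglyMeasurable ?_
  rw [Measure.prod_restrict]
  filter_upwards [ae_restrict_mem (measurableSet_Ioc.prod measurableSet_Ioc)] with p hp
  rw [Complex.norm_real]
  exact hC p ⟨Ioc_subset_Icc_self hp.1, Ioc_subset_Icc_self hp.2⟩

theorem intervalIntegrable_mul_of_continuous (hL : 0 ≤ L) {a : ℝ → ℝ} (ha : Continuous a)
    {f : ℝ → ℂ} (hf : Integrable f (volume.restrict (Ioc (-L) L))) :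
    IntervalIntegrable (fun t => (a t : ℂ) * f t) volume (-L) L :=
  ((intervalIntegrable_iff_integrableOn_Ioc_of_le (by linarith)).2 hf).continuousOn_mul
    (by fun_prop)

theorem integrable_intOp (hL : 0 ≤ L) {k : ℝ → ℝ → ℝ}
    (hk : Continuous fun p : ℝ × ℝ => k p.1 p.2) {f : ℝ → ℂ}
    (hf : Integrable f (volume.restrict (Ioc (-L) L))) :
    Integrable (intOp L k f) (volume.restrict (Ioc (-L) L)) := by
  refine (integrable_mul_of_continuous hk hf).integral_prod_left.congr
    (Filter.Eventually.of_forall fun x => ?_)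
  rw [intOp, intervalIntegral.integral_of_le (by linarith)]

/-- The kernel of the composition of two integral operators. -/
def compKernel (L : ℝ) (k l : ℝ → ℝ → ℝ) (x t : ℝ) : ℝ := ∫ s in (-L)..L, k x s * l s t

theorem continuous_compKernel {k l : ℝ → ℝ → ℝ} (hk : Continuous fun p : ℝ × ℝ => k p.1 p.2)
    (hl : Continuous fun p : ℝ × ℝ => l p.1 p.2) :
    Continuous fun p : ℝ × ℝ => compKernel L k l p.1 p.2 := by
  refine intervalIntegral.continuous_parametric_intervalIntegral_of_continuous'
    (f := fun (p : ℝ × ℝ) s => k p.1 s * l s p.2) ?_ _ _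
  exact (hk.comp (by fun_prop : Continuous fun q : (ℝ × ℝ) × ℝ => (q.1.1, q.2))).mul
    (hl.comp (by fun_prop : Continuous fun q : (ℝ × ℝ) × ℝ => (q.2, q.1.2)))

theorem compKernel_assoc {k l m : ℝ → ℝ → ℝ} (hk : Continuous fun p : ℝ × ℝ => k p.1 p.2)
    (hl : Continuous fun p : ℝ × ℝ => l p.1 p.2) (hm : Continuous fun p : ℝ × ℝ => m p.1 p.2)
    (x t : ℝ) :
    compKernel L k (compKernel L l m) x t = compKernel L (compKernel L k l) m x t := by
  simp only [compKernel]
  simp_rw [← intervalIntegral.integral_const_mul, ← intervalIntegral.integral_mul_const]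
  rw [integral_integral_swap_of_continuous (F := fun s y => k x s * (l s y * m y t))]
  · simp_rw [mul_assoc]
  · exact (hk.comp (by fun_prop : Continuous fun q : ℝ × ℝ => (x, q.1))).mul
      ((hl.comp (by fun_prop : Continuous fun q : ℝ × ℝ => (q.1, q.2))).mul
      (hm.comp (by fun_prop : Continuous fun q : ℝ × ℝ => (q.2, t))))

theorem intOp_intOp (hL : 0 ≤ L) {k l : ℝ → ℝ → ℝ} (hk : Continuous fun p : ℝ × ℝ => k p.1 p.2)
    (hl : Continuous fun p : ℝ × ℝ => l p.1 p.2) {f : ℝ → ℂ}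
    (hf : Integrable f (volume.restrict (Ioc (-L) L))) (x : ℝ) :
    intOp L k (intOp L l f) x = intOp L (compKernel L k l) f x := by
  have hL' : -L ≤ L := by linarith
  have h1 : Integrable (Function.uncurry fun s t => ((k x s * l s t : ℝ) : ℂ) * f t)
      ((volume.restrict (Ioc (-L) L)).prod (volume.restrict (Ioc (-L) L))) :=
    integrable_mul_of_continuous (F := fun p : ℝ × ℝ => k x p.1 * l p.1 p.2)
      ((hk.comp (by fun_prop : Continuous fun q : ℝ × ℝ => (x, q.1))).mul hl) hf
  simp only [intOp, compKernel]
  simp_rw [← intervalIntegral.integral_ofReal, ← intervalIntegral.integral_const_mul,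
    ← intervalIntegral.integral_mul_const]
  simp_rw [intervalIntegral.integral_of_le hL', ← mul_assoc, ← Complex.ofReal_mul]
  exact integral_integral_swap h1

theorem intOp_add (hL : 0 ≤ L) {k : ℝ → ℝ → ℝ} (hk : Continuous fun p : ℝ × ℝ => k p.1 p.2)
    {f g : ℝ → ℂ} (hf : Integrable f (volume.restrict (Ioc (-L) L)))
    (hg : Integrable g (volume.restrict (Ioc (-L) L))) (x : ℝ) :
    intOp L k (fun y => f y + g y) x = intOp L k f x + intOp L k g x := by
  have hkx : Continuous (k x) := hk.comp (by fun_prop : Continuous fun t : ℝ => (x, t))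
  simp only [intOp, mul_add]
  exact intervalIntegral.integral_add (intervalIntegrable_mul_of_continuous hL hkx hf)
    (intervalIntegrable_mul_of_continuous hL hkx hg)

theorem intOp_sub (hL : 0 ≤ L) {k : ℝ → ℝ → ℝ} (hk : Continuous fun p : ℝ × ℝ => k p.1 p.2)
    {f g : ℝ → ℂ} (hf : Integrable f (volume.restrict (Ioc (-L) L)))
    (hg : Integrable g (volume.restrict (Ioc (-L) L))) (x : ℝ) :
    intOp L k (fun y => f y - g y) x = intOp L k f x - intOp L k g x := by
  have hkx : Continuous (k x) := hk.comp (by fun_prop : Continuous fun t : ℝ => (x, t))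
  simp only [intOp, mul_sub]
  exact intervalIntegral.integral_sub (intervalIntegrable_mul_of_continuous hL hkx hf)
    (intervalIntegrable_mul_of_continuous hL hkx hg)

theorem intOp_eq_add (hL : 0 ≤ L) {k l m : ℝ → ℝ → ℝ}
    (hl : Continuous fun p : ℝ × ℝ => l p.1 p.2) (hm : Continuous fun p : ℝ × ℝ => m p.1 p.2)
    {f : ℝ → ℂ} (hf : Integrable f (volume.restrict (Ioc (-L) L))) {x : ℝ}
    (h : ∀ t, k x t = l x t + m x t) :
    intOp L k f x = intOp L l f x + intOp L m f x := by
  have hlx : Continuous (l x) := hl.comp (by fun_prop : Continuous fun t : ℝ => (x, t))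
  have hmx : Continuous (m x) := hm.comp (by fun_prop : Continuous fun t : ℝ => (x, t))
  simp only [intOp, h, Complex.ofReal_add, add_mul]
  exact intervalIntegral.integral_add (intervalIntegrable_mul_of_continuous hL hlx hf)
    (intervalIntegrable_mul_of_continuous hL hmx hf)

/-- A continuous kernel on `[-L, L]` has a resolvent kernel if `1` is not an eigenvalue. -/
theorem exists_isResolventKernel (hL : 0 < L) {k : ℝ → ℝ → ℝ}
    (hk : Continuous fun p : ℝ × ℝ => k p.1 p.2)
    (hinj : ∀ f : ℝ → ℝ, Continuous f →
      (∀ x ∈ Icc (-L) L, f x = ∫ t in (-L)..L, k x t * f t) → ∀ x ∈ Icc (-L) L, f x = 0) :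
    ∃ q : ℝ → ℝ → ℝ, IsResolventKernel L k q := by
  obtain ⟨w, hwc, hw⟩ := exists_solution (Z := ℝ) hL (k := fun _ => k) (φ := fun t x => k x t)
    (hk.comp (by fun_prop : Continuous fun p : ℝ × ℝ × ℝ => p.2))
    (hk.comp (by fun_prop : Continuous fun p : ℝ × ℝ => (p.2, p.1))) fun _ => hinj
  let q : ℝ → ℝ → ℝ := fun x t => w t x
  have hq : Continuous fun p : ℝ × ℝ => q p.1 p.2 :=
    hwc.comp (by fun_prop : Continuous fun p : ℝ × ℝ => (p.2, p.1))
  have h1 : ∀ x t, q x t = k x t + compKernel L k q x t := fun x t => hw t x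
  have hkq := continuous_compKernel (L := L) hk hq
  have hqk := continuous_compKernel (L := L) hq hk
  have hkk := continuous_compKernel (L := L) hk hk
  have hkqk := continuous_compKernel (L := L) hk hqk
  have hii : ∀ f : ℝ → ℝ, Continuous f → IntervalIntegrable f volume (-L) L :=
    fun f hf => hf.intervalIntegrable _ _
  have h2 : ∀ x ∈ Icc (-L) L, ∀ t, q x t = k x t + compKernel L q k x t := by
    intro x hx t
    have sec : ∀ {F : ℝ → ℝ → ℝ}, (Continuous fun p : ℝ × ℝ => F p.1 p.2) →
        Continuous fun x => F x t := fun hF =>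
      hF.comp (by fun_prop : Continuous fun x : ℝ => (x, t))
    have sec' : ∀ {F : ℝ → ℝ → ℝ} (x : ℝ), (Continuous fun p : ℝ × ℝ => F p.1 p.2) →
        Continuous (F x) := fun x hF =>
      hF.comp (by fun_prop : Continuous fun t : ℝ => (x, t))
    -- The construction gives only `q = k + k ∘ q`. As a function of `x`, the defect `q - k - q ∘ k`
    -- is fixed by the operator `k`, so injectivity makes it vanish and yields the other composition
    -- identity.
    have h3 : q x t - k x t - compKernel L q k x t = 0 := by
      refine hinj (fun x => q x t - k x t - compKernel L q k x t)
        (((sec hq).sub (sec hk)).sub (sec hqk)) (fun y _ => ?_) x hx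
      have e1 : ∫ s in (-L)..L, k y s * (q s t - k s t - compKernel L q k s t) =
          compKernel L k q y t - compKernel L k k y t - compKernel L k (compKernel L q k) y t := by
        simp only [mul_sub]
        rw [intervalIntegral.integral_sub, intervalIntegral.integral_sub]
        · rfl
        · exact hii _ ((sec' y hk).mul (sec hq))
        · exact hii _ ((sec' y hk).mul (sec hk))
        · exact hii _ (((sec' y hk).mul (sec hq)).sub ((sec' y hk).mul (sec hk)))
        · exact hii _ ((sec' y hk).mul (sec hqk))
      have e2 : compKernel L q k y t =
          compKernel L k k y t + compKernel L (compKernel L k q) k y t := by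
        simp only [compKernel]
        rw [← intervalIntegral.integral_add]
        · refine intervalIntegral.integral_congr fun s _ => ?_
          simp only [h1 y s, add_mul]
          rfl
        · exact hii _ ((sec' y hk).mul (sec hk))
        · exact hii _ ((sec' y hkq).mul (sec hk))
      rw [e1, compKernel_assoc hk hq hk, e2, h1 y t]
      ring
    linarith
  refine ⟨q, hq.continuousOn, fun f hf => ?_⟩
  have hfi : Integrable f (volume.restrict (Ioc (-L) L)) := hf.integrable one_le_two
  constructor
  · refine Filter.Eventually.of_forall fun x => ?_
    simp only
    rw [intOp_add hL.le hk hfi (integrable_intOp hL.le hq hfi), intOp_intOp hL.le hk hq hfi,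
      intOp_eq_add hL.le hk hkq hfi (h1 x)]
    ring
  · filter_upwards [ae_restrict_mem measurableSet_Ioc] with x hx
    rw [intOp_sub hL.le hq hfi (integrable_intOp hL.le hk hfi), intOp_intOp hL.le hq hk hfi,
      intOp_eq_add hL.le hk hqk hfi (h2 x (Ioc_subset_Icc_self hx))]
    ring

/-- The resolvent kernel yields a continuous solution, valid at every point of `[-L, L]`, of the
integral equation with a continuous right-hand side. -/
theorem IsResolventKernel.exists_continuous_eqOn (hL : 0 < L) {k q : ℝ → ℝ → ℝ}
    (hk : Continuous fun p : ℝ × ℝ => k p.1 p.2) (hq : IsResolventKernel L k q) {f : ℝ → ℂ}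
    (hf : Continuous f) :
    ∃ u : ℝ → ℂ, Continuous u ∧ (∀ x ∈ Icc (-L) L, u x = f x + intOp L q f x) ∧
      ∀ x ∈ Icc (-L) L, u x = f x + intOp L k u x := by
  have hL' : -L ≤ L := by linarith
  have hint : ∀ {l : ℝ → ℝ → ℝ} {g : ℝ → ℂ}, (Continuous fun p : ℝ × ℝ => l p.1 p.2) →
      Continuous g → Continuous (intOp L l g) := fun {l g} hl hg => by
    refine intervalIntegral.continuous_parametric_intervalIntegral_of_continuous'
      (f := fun x t => (l x t : ℂ) * g t) ?_ _ _
    exact (Complex.continuous_ofReal.comp hl).mul (hg.comp continuous_snd)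
  -- Only continuity on the square is known, so `q` is extended by clamping both variables.
  let q' : ℝ → ℝ → ℝ := fun x t => q (projIcc (-L) L hL' x) (projIcc (-L) L hL' t)
  have hq' : Continuous fun p : ℝ × ℝ => q' p.1 p.2 :=
    hq.1.comp_continuous (f := fun p : ℝ × ℝ => ((projIcc (-L) L hL' p.1 : ℝ),
      (projIcc (-L) L hL' p.2 : ℝ))) (by fun_prop)
      fun p => ⟨(projIcc (-L) L hL' p.1).2, (projIcc (-L) L hL' p.2).2⟩
  have hqq : ∀ x ∈ Icc (-L) L, intOp L q' f x = intOp L q f x := by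
    intro x hx
    refine intervalIntegral.integral_congr fun t ht => ?_
    rw [uIcc_of_le hL'] at ht
    simp only [q', projIcc_of_mem hL' hx, projIcc_of_mem hL' ht]
  let u : ℝ → ℂ := fun x => f x + intOp L q' f x
  have hu : Continuous u := hf.add (hint hq' hf)
  have huq : ∀ x ∈ Icc (-L) L, u x = f x + intOp L q f x := fun x hx => by
    simp only [u, hqq x hx]
  refine ⟨u, hu, huq, ?_⟩
  have hf2 : MemLp f 2 (volume.restrict (Ioc (-L) L)) := by
    obtain ⟨C, hC⟩ := isCompact_Icc.exists_bound_of_continuousOn (s := Icc (-L) L) hf.continuousOn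
    refine MemLp.of_bound hf.aestronglyMeasurable C ?_
    filter_upwards [ae_restrict_mem measurableSet_Ioc] with t ht
    exact hC t (Ioc_subset_Icc_self ht)
  have h1 : u =ᵐ[volume.restrict (Icc (-L) L)] fun x => f x + intOp L k u x := by
    rw [← restrict_Ioc_eq_restrict_Icc]
    filter_upwards [(hq.2 f hf2).1, ae_restrict_mem measurableSet_Ioc] with x hx hxm
    have e1 : intOp L k (fun y => f y + intOp L q f y) x = intOp L k u x := by
      refine intervalIntegral.integral_congr fun t ht => ?_
      rw [uIcc_of_le hL'] at ht
      simp only [huq t ht]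
    rw [e1, ← huq x (Ioc_subset_Icc_self hxm)] at hx
    exact eq_add_of_sub_eq hx
  -- Continuity upgrades the almost-everywhere identity to every point, in particular to the
  -- endpoint at which `r` is evaluated.
  exact fun x hx => Measure.eqOn_Icc_of_ae_eq volume (by linarith) h1 hu.continuousOn
    (hf.add (hint hk hu)).continuousOn hx

end Resolvent

/-! ### Cosine and sine solutions, and their boundary values -/

theorem continuous_sineKernel : Continuous fun p : ℝ × ℝ => sineKernel p.1 p.2 :=
  continuous_sineFun.comp (by fun_prop : Continuous fun p : ℝ × ℝ => ((1 : ℝ), p.1 - p.2))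

theorem isResolventKernel_Q {ζ : ℝ} (hζ : 0 < ζ) : IsResolventKernel ζ sineKernel (Q ζ) := by
  have h : ∃ q : ℝ → ℝ → ℝ, IsResolventKernel ζ sineKernel q :=
    exists_isResolventKernel hζ continuous_sineKernel fun f hf h =>
      eq_zero_of_eq_integral_sineKernel hζ hf.continuousOn h
  rw [Q, dif_pos h]
  exact h.choose_spec

/-- `w z` solves the integral equation on `[-1, 1]` with kernel `kPM ε z` and right-hand side
`trigPM ε (z * ·)`. -/
def IsTrigSolution (ε : ℝ) (w : ℝ → ℝ → ℝ) : Prop :=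
  (Continuous fun p : ℝ × ℝ => w p.1 p.2) ∧
    ∀ z x, w z x = trigPM ε (z * x) + ∫ t in (-1 : ℝ)..1, kPM ε z x t * w z t

theorem exists_isTrigSolution {ε : ℝ} (hε : ε = 1 ∨ ε = -1) : ∃ w, IsTrigSolution ε w :=
  exists_solution (Z := ℝ) one_pos (continuous_kPM ε)
    ((continuous_trigPM ε).comp (by fun_prop : Continuous fun p : ℝ × ℝ => p.1 * p.2))
    fun _ _ hf h => eq_zero_of_eq_integral_kPM hε hf.continuousOn h

namespace IsTrigSolution

variable {ε : ℝ} {w : ℝ → ℝ → ℝ}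

theorem map_neg (hw : IsTrigSolution ε w) (hε : ε = 1 ∨ ε = -1) (z x : ℝ) :
    w z (-x) = ε * w z x := by
  rw [hw.2 z (-x), hw.2 z x, mul_neg, trigPM_neg hε, mul_add,
    ← intervalIntegral.integral_const_mul]
  simp only [kPM_neg_left hε, mul_assoc]

theorem continuous_scaled (hw : IsTrigSolution ε w) (z : ℝ) : Continuous fun x => w z (x / z) :=
  hw.1.comp (by fun_prop : Continuous fun x : ℝ => (z, x / z))

/-- The equation of a solution after rescaling to `[-z, z]`. -/
theorem scaled (hw : IsTrigSolution ε w) {z : ℝ} (hz : 0 < z) (x : ℝ) :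
    w z (x / z) = trigPM ε x + ∫ t in (-z)..z, kPM ε 1 x t * w z (t / z) := by
  have h1 := intervalIntegral.mul_integral_comp_mul_left (a := -1) (b := 1)
    (f := fun t => kPM ε 1 x t * w z (t / z)) z
  rw [mul_neg, mul_one] at h1
  rw [hw.2 z (x / z), ← h1, ← intervalIntegral.integral_const_mul, mul_div_cancel₀ _ hz.ne']
  congr 1
  refine intervalIntegral.integral_congr fun t _ => ?_
  rw [← mul_kPM_one, mul_div_cancel₀ _ hz.ne', mul_div_cancel_left₀ _ hz.ne', mul_assoc]

/-- Uniqueness for the integral equation with the sine kernel. -/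
theorem eqOn_scaled (hw : IsTrigSolution ε w) (hε : ε = 1 ∨ ε = -1) {z : ℝ} (hz : 0 < z)
    {u : ℝ → ℝ} (hu : Continuous u)
    (h : ∀ x ∈ Icc (-z) z, u x = trigPM ε x + ∫ t in (-z)..z, sineKernel x t * u t) :
    ∀ x ∈ Icc (-z) z, u x = w z (x / z) := by
  intro x hx
  rw [← sub_eq_zero]
  refine eq_zero_of_eq_integral_sineKernel hz (f := fun x => u x - w z (x / z))
    (hu.sub (hw.continuous_scaled z)).continuousOn (fun y hy => ?_) x hx
  have hs : Continuous (sineKernel y) :=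
    continuous_sineKernel.comp (by fun_prop : Continuous fun t : ℝ => (y, t))
  rw [h y hy, hw.scaled hz y, integral_kPM_mul hε hz.le (hw.continuous_scaled z).continuousOn
    (fun t _ => by rw [neg_div, hw.map_neg hε])]
  simp only [mul_sub]
  rw [intervalIntegral.integral_sub (f := fun t => sineKernel y t * u t)
    (g := fun t => sineKernel y t * w z (t / z)) ((hs.mul hu).intervalIntegrable _ _)
    ((hs.mul (hw.continuous_scaled z)).intervalIntegrable _ _)]
  simp only [sineKernel]
  ring

end IsTrigSolution

/-- The real and imaginary part of `r` are boundary values of the even and odd solution. -/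
theorem r_eq {w v : ℝ → ℝ → ℝ} (hw : IsTrigSolution 1 w) (hv : IsTrigSolution (-1) v) {s : ℝ}
    (hs : 0 < s) : r s = (w s 1 : ℂ) + (v s 1 : ℂ) * Complex.I := by
  obtain ⟨u, huc, huq, hu⟩ := (isResolventKernel_Q hs).exists_continuous_eqOn hs
    continuous_sineKernel (f := fun x => Complex.exp (-(Complex.I * x * Real.pi))) (by fun_prop)
  have hms : -s ∈ Icc (-s) s := ⟨le_rfl, by linarith⟩
  -- By definition `r s` is `(I + Q) e^{-iπ·}` at the left endpoint. The real part of `u` solves the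
  -- cosine equation, and minus its imaginary part solves the sine equation.
  have hr : r s = u (-s) := by
    rw [huq _ hms, r, intOp]
    congr 2
    push_cast
    ring
  have hexp : ∀ x : ℝ, Complex.exp (-(Complex.I * x * Real.pi)) =
      (Real.cos (Real.pi * x) : ℂ) - (Real.sin (Real.pi * x) : ℂ) * Complex.I := by
    intro x
    have : -(Complex.I * x * Real.pi) = ((-(Real.pi * x) : ℝ) : ℂ) * Complex.I := by
      push_cast; ring
    rw [this, Complex.exp_mul_I, ← Complex.ofReal_cos, ← Complex.ofReal_sin, Real.cos_neg,
      Real.sin_neg]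
    push_cast
    ring
  have hi : ∀ x, IntervalIntegrable (fun t => (sineKernel x t : ℂ) * u t) volume (-s) s :=
    fun x => ((Complex.continuous_ofReal.comp (continuous_sineKernel.comp
      (by fun_prop : Continuous fun t : ℝ => (x, t)))).mul huc).intervalIntegrable _ _
  have hre : ∀ x ∈ Icc (-s) s, (u x).re = w s (x / s) := by
    refine hw.eqOn_scaled (Or.inl rfl) hs (Complex.continuous_re.comp huc) fun x hx => ?_
    have h1 : ∫ t in (-s)..s, sineKernel x t * (u t).re = (intOp s sineKernel u x).re := by
      have := Complex.reCLM.intervalIntegral_comp_comm (hi x)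
      simp only [Complex.reCLM_apply, Complex.re_ofReal_mul] at this
      exact this
    change (u x).re = _ + ∫ t in (-s)..s, sineKernel x t * (u t).re
    rw [h1, trigPM_one, congrArg Complex.re (hu x hx), hexp, Complex.add_re, Complex.sub_re,
      Complex.ofReal_re, Complex.re_ofReal_mul, Complex.I_re, mul_zero, sub_zero]
  have him : ∀ x ∈ Icc (-s) s, -(u x).im = v s (x / s) := by
    refine hv.eqOn_scaled (Or.inr rfl) hs (Complex.continuous_im.comp huc).neg fun x hx => ?_
    have h1 : ∫ t in (-s)..s, sineKernel x t * (u t).im = (intOp s sineKernel u x).im := by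
      have := Complex.imCLM.intervalIntegral_comp_comm (hi x)
      simp only [Complex.imCLM_apply, Complex.im_ofReal_mul] at this
      exact this
    simp only [mul_neg, intervalIntegral.integral_neg]
    rw [h1, trigPM_neg_one, congrArg Complex.im (hu x hx), hexp, Complex.add_im, Complex.sub_im,
      Complex.ofReal_im, Complex.im_ofReal_mul, Complex.I_im]
    ring
  have h1 := hre _ hms
  have h2 := him _ hms
  rw [neg_div, div_self hs.ne'] at h1 h2
  rw [hw.map_neg (Or.inl rfl)] at h1
  rw [hv.map_neg (Or.inr rfl)] at h2
  rw [hr]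
  apply Complex.ext
  · simp [h1]
  · simp; linarith

theorem norm_r_sq {w v : ℝ → ℝ → ℝ} (hw : IsTrigSolution 1 w) (hv : IsTrigSolution (-1) v) {s : ℝ}
    (hs : 0 < s) : ‖r s ^ 2‖ = w s 1 ^ 2 + v s 1 ^ 2 := by
  rw [norm_pow, r_eq hw hv hs, Complex.sq_norm, Complex.normSq_add_mul_I]

/-! ### The pairing and its derivative in the length of the interval -/

namespace IsTrigSolution

variable {ε : ℝ} {w : ℝ → ℝ → ℝ}

/-- The pairing of the solution `w z` with the right-hand side of its equation. -/
def pairing (ε : ℝ) (w : ℝ → ℝ → ℝ) (z : ℝ) : ℝ := ∫ x in (-1 : ℝ)..1, w z x * trigPM ε (z * x)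

theorem continuous_pairing (hw : IsTrigSolution ε w) : Continuous (pairing ε w) := by
  have := continuous_trigPM ε
  have := hw.1
  exact intervalIntegral.continuous_parametric_intervalIntegral_of_continuous'
    (f := fun z x => w z x * trigPM ε (z * x)) (by fun_prop) _ _

theorem mul_pairing {z : ℝ} (hz : 0 < z) :
    z * pairing ε w z = ∫ x in (-z)..z, w z (x / z) * trigPM ε x := by
  have h1 := intervalIntegral.mul_integral_comp_mul_left (a := -1) (b := 1)
    (f := fun x => w z (x / z) * trigPM ε x) z
  rw [mul_neg, mul_one] at h1
  rw [← h1, pairing]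
  simp only [mul_div_cancel_left₀ _ hz.ne']

theorem integral_scaled_mul_scaled (hw : IsTrigSolution ε w) (hε : ε = 1 ∨ ε = -1) (y z L : ℝ) :
    ∫ x in (-L)..L, w y (x / y) * w z (x / z) = 2 * ∫ x in (0 : ℝ)..L, w y (x / y) * w z (x / z) := by
  have hi : ∀ a b, IntervalIntegrable (fun x => w y (x / y) * w z (x / z)) volume a b := fun a b =>
    ((hw.continuous_scaled y).mul (hw.continuous_scaled z)).intervalIntegrable a b
  have h1 := intervalIntegral.integral_comp_neg (a := 0) (b := L)
    (fun x => w y (x / y) * w z (x / z))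
  have h2 : ∀ x, w y (-x / y) * w z (-x / z) = w y (x / y) * w z (x / z) := by
    intro x
    rw [neg_div, neg_div, hw.map_neg hε, hw.map_neg hε]
    rcases hε with rfl | rfl <;> ring
  simp only [h2, neg_zero] at h1
  rw [← intervalIntegral.integral_add_adjacent_intervals (hi _ 0) (hi 0 _), ← h1]
  ring

/-- In `∫ W_y φ` over `[-y, y]`, with `W_z x = w z (x / z)`, substitute `φ = W_z - K W_z` from the
equation of the other interval, valid on all of `ℝ`. Exchanging `y` and `z` produces the same double
integral over `[-y, y] × [-z, z]`, because the kernel is symmetric. The difference keeps only the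
integrals of the even function `W_y W_z`. -/
theorem mul_pairing_sub (hw : IsTrigSolution ε w) (hε : ε = 1 ∨ ε = -1) {y z : ℝ} (hy : 0 < y)
    (hz : 0 < z) :
    y * pairing ε w y - z * pairing ε w z = 2 * ∫ x in z..y, w y (x / y) * w z (x / z) := by
  have hk : Continuous fun p : ℝ × ℝ => kPM ε 1 p.1 p.2 :=
    (continuous_kPM ε).comp (by fun_prop : Continuous fun p : ℝ × ℝ => ((1 : ℝ), p.1, p.2))
  have key : ∀ {y z : ℝ}, 0 < y → 0 < z → y * pairing ε w y =
      (∫ x in (-y)..y, w y (x / y) * w z (x / z)) -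
        ∫ x in (-y)..y, ∫ t in (-z)..z, w y (x / y) * (kPM ε 1 x t * w z (t / z)) := by
    intro y z hy hz
    have hy' := hw.continuous_scaled y
    have hz' := hw.continuous_scaled z
    rw [mul_pairing hy, ← intervalIntegral.integral_sub]
    · refine intervalIntegral.integral_congr fun x _ => ?_
      rw [intervalIntegral.integral_const_mul, hw.scaled hz x]
      ring
    · exact (hy'.mul hz').intervalIntegrable _ _
    · refine Continuous.intervalIntegrable ?_ _ _
      refine intervalIntegral.continuous_parametric_intervalIntegral_of_continuous'
        (f := fun x t => w y (x / y) * (kPM ε 1 x t * w z (t / z))) ?_ _ _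
      exact (hy'.comp continuous_fst).mul (hk.mul (hz'.comp continuous_snd))
  have hy' := hw.continuous_scaled y
  have hz' := hw.continuous_scaled z
  have h1 : ∫ x in (-z)..z, ∫ t in (-y)..y, w z (x / z) * (kPM ε 1 x t * w y (t / y)) =
      ∫ x in (-y)..y, ∫ t in (-z)..z, w y (x / y) * (kPM ε 1 x t * w z (t / z)) := by
    rw [integral_integral_swap_of_continuous
      (F := fun x t => w z (x / z) * (kPM ε 1 x t * w y (t / y)))
      ((hz'.comp continuous_fst).mul (hk.mul (hy'.comp continuous_snd)))]
    refine intervalIntegral.integral_congr fun t _ =>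
      intervalIntegral.integral_congr fun x _ => ?_
    rw [kPM_symm]
    ring
  have h2 : ∫ x in (-z)..z, w z (x / z) * w y (x / y) =
      ∫ x in (-z)..z, w y (x / y) * w z (x / z) := by simp only [mul_comm]
  rw [key hy hz, key hz hy, h1, h2, sub_sub_sub_cancel_right, hw.integral_scaled_mul_scaled hε,
    hw.integral_scaled_mul_scaled hε, ← mul_sub, intervalIntegral.integral_interval_sub_left] <;>
  exact (hy'.mul hz').intervalIntegrable _ _

/-- The exact difference formula makes joint continuity of `w` sufficient: no derivative of the
solution in its parameter is needed. The integrand tends to `w z 1 ^ 2` as both `y` and `x` tend to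
`z`. -/
theorem hasDerivAt_mul_pairing (hw : IsTrigSolution ε w) (hε : ε = 1 ∨ ε = -1) {z : ℝ}
    (hz : 0 < z) : HasDerivAt (fun y => y * pairing ε w y) (2 * w z 1 ^ 2) z := by
  rw [hasDerivAt_iff_isLittleO, Asymptotics.isLittleO_iff]
  intro c hc
  have hF : ContinuousAt (fun p : ℝ × ℝ => w p.1 (p.2 / p.1) * w z (p.2 / z)) (z, z) := by
    have h1 : ContinuousAt (fun p : ℝ × ℝ => (p.1, p.2 / p.1)) (z, z) :=
      continuousAt_fst.prodMk (continuousAt_snd.div continuousAt_fst hz.ne')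
    have h2 : ContinuousAt (fun p : ℝ × ℝ => w p.1 (p.2 / p.1)) (z, z) :=
      ContinuousAt.comp (f := fun p : ℝ × ℝ => (p.1, p.2 / p.1)) hw.1.continuousAt h1
    exact h2.mul ((hw.continuous_scaled z).comp continuous_snd).continuousAt
  obtain ⟨δ, hδ, hd⟩ := Metric.continuousAt_iff.1 hF (c / 2) (by positivity)
  filter_upwards [Metric.ball_mem_nhds z (lt_min hδ hz)] with y hy
  rw [Metric.mem_ball, Real.dist_eq] at hy
  have hyδ := hy.trans_le (min_le_left _ _)
  have hy0 : 0 < y := by linarith [(abs_lt.1 (hy.trans_le (min_le_right _ _))).1]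
  have h1 : ∫ x in z..y, (w y (x / y) * w z (x / z) - w z 1 ^ 2) =
      (∫ x in z..y, w y (x / y) * w z (x / z)) - (y - z) * w z 1 ^ 2 := by
    rw [intervalIntegral.integral_sub _ (by simp), intervalIntegral.integral_const, smul_eq_mul]
    exact ((hw.continuous_scaled y).mul (hw.continuous_scaled z)).intervalIntegrable _ _
  have h2 : ‖∫ x in z..y, (w y (x / y) * w z (x / z) - w z 1 ^ 2)‖ ≤ c / 2 * |y - z| := by
    refine intervalIntegral.norm_integral_le_of_norm_le_const fun x hx => ?_
    have hxz : |x - z| ≤ |y - z| :=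
      abs_sub_left_of_mem_uIcc (uIoc_subset_uIcc hx)
    have h3 : dist (y, x) (z, z) < δ := by
      rw [Prod.dist_eq, Real.dist_eq, Real.dist_eq]
      exact max_lt hyδ (hxz.trans_lt hyδ)
    have h4 := hd h3
    rw [Real.dist_eq, div_self hz.ne', ← sq] at h4
    exact h4.le
  rw [hw.mul_pairing_sub hε hy0 hz, smul_eq_mul, Real.norm_eq_abs (y - z)]
  have h3 : 2 * (∫ x in z..y, w y (x / y) * w z (x / z)) - (y - z) * (2 * w z 1 ^ 2) =
      2 * ∫ x in z..y, (w y (x / y) * w z (x / z) - w z 1 ^ 2) := by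
    rw [h1]; ring
  rw [h3, norm_mul, Real.norm_two]
  linarith

theorem integral_boundary_sq (hw : IsTrigSolution ε w) (hε : ε = 1 ∨ ε = -1) {z : ℝ}
    (hz : 0 < z) : ∫ s in (0 : ℝ)..z, 2 * w s 1 ^ 2 = z * pairing ε w z := by
  have hc : Continuous fun s => 2 * w s 1 ^ 2 :=
    ((hw.1.comp (by fun_prop : Continuous fun s : ℝ => (s, (1 : ℝ)))).pow 2).const_mul 2
  rw [intervalIntegral.integral_eq_sub_of_hasDerivAt_of_le (f := fun y => y * pairing ε w y) hz.le
    (continuous_id.mul hw.continuous_pairing).continuousOn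
    (fun y hy => hw.hasDerivAt_mul_pairing hε hy.1) (hc.intervalIntegrable _ _)]
  simp

end IsTrigSolution

/-! ### The determinants `P_±`: derivative, positivity and logarithm -/

section Determinant

variable {ε : ℝ}

theorem fredholmTerm_one (k : ℝ → ℝ → ℝ) (a b : ℝ) (n : ℕ) :
    fredholmTerm k a b 1 n =
      altFactorial n * fredholmCoeff (volume.restrict (Icc a b)) k n := by
  rw [fredholmTerm, altFactorial, fredholmCoeff, volume_pi, Measure.restrict_pi_pi]
  rfl

theorem summable_fredholmTerm_kPM (hε : ε = 1 ∨ ε = -1) (z : ℝ) :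
    Summable (fredholmTerm (kPM ε z) (-1) 1 1) := by
  simp_rw [funext (fredholmTerm_one (kPM ε z) (-1) 1)]
  exact summable_altFactorial_mul_fredholmCoeff _ (abs_nonneg z) (abs_kPM_le hε z)

theorem P_one (ε z : ℝ) : P ε z 1 =
    ∑' n, altFactorial n * fredholmCoeff (volume.restrict (Icc (-1) 1)) (kPM ε z) n := by
  simp_rw [P, fredholmDet, fredholmTerm_one]

theorem P_zero_one (ε : ℝ) : P ε 0 1 = 1 := by
  rw [P_one, tsum_eq_single 0]
  · simp [altFactorial, fredholmCoeff_zero]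
  · intro n hn
    have : Nonempty (Fin n) := ⟨⟨0, Nat.pos_of_ne_zero hn⟩⟩
    have h1 : ∀ y : Fin n → ℝ, kernelMatrix (kPM ε 0) y = 0 := by
      intro y
      ext i j
      simp [kernelMatrix, kPM, sineFun]
    simp [fredholmCoeff, h1, Matrix.det_zero]

variable {w : ℝ → ℝ → ℝ}

theorem hasDerivAt_P (hε : ε = 1 ∨ ε = -1) (hw : IsTrigSolution ε w) (ζ : ℝ) :
    HasDerivAt (fun z => P ε z 1) (-IsTrigSolution.pairing ε w ζ * P ε ζ 1) ζ := by
  have hIcc : ∀ f : ℝ → ℝ, ∫ x in Icc (-1 : ℝ) 1, f x = ∫ x in (-1 : ℝ)..1, f x := fun f => by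
    rw [intervalIntegral.integral_of_le (by norm_num), integral_Icc_eq_integral_Ioc]
  have hwc : Continuous (w ζ) := hw.1.comp (by fun_prop : Continuous fun x : ℝ => (ζ, x))
  have h1 := hasDerivAt_tsum_fredholmCoeff (volume.restrict (Icc (-1 : ℝ) 1)) (k := kPM ε)
    (φ := fun z x => trigPM ε (z * x)) (M := |ζ| + 1) (ζ := ζ) (w := w ζ)
    (fun z => (continuous_kPM ε).comp (by fun_prop : Continuous fun p : ℝ × ℝ => (z, p)))
    (fun z => (continuous_trigPM ε).comp (by fun_prop)) (by positivity)
    (fun z hz x t => (abs_kPM_le hε z x t).trans (by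
      rw [Metric.mem_ball, Real.dist_eq] at hz
      linarith [abs_sub_abs_le_abs_sub z ζ]))
    (fun z _ x => (abs_trigPM_le hε _).trans (by linarith [abs_nonneg ζ]))
    (hasDerivAt_kPM hε) (hwc.continuousOn.integrableOn_compact isCompact_Icc)
    (fun x => by rw [hIcc]; exact hw.2 ζ x)
  simp_rw [← P_one, hIcc] at h1
  exact h1

/-- By the equation `P' = -B P`, the product of `P` with the exponential of `∫ B` is constant, and
it equals `1` at `0`, where the kernel vanishes. -/
theorem P_one_pos (hε : ε = 1 ∨ ε = -1) (hw : IsTrigSolution ε w) (z : ℝ) : 0 < P ε z 1 := by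
  have hB := hw.continuous_pairing
  have hE : ∀ z, HasDerivAt (fun z => P ε z 1 *
      Real.exp (∫ s in (0 : ℝ)..z, IsTrigSolution.pairing ε w s)) 0 z := by
    intro z
    have h1 : HasDerivAt (fun z => ∫ s in (0 : ℝ)..z, IsTrigSolution.pairing ε w s)
        (IsTrigSolution.pairing ε w z) z :=
      intervalIntegral.integral_hasDerivAt_right (hB.intervalIntegrable _ _)
        (hB.stronglyMeasurableAtFilter _ _) hB.continuousAt
    convert! (hasDerivAt_P hε hw z).mul h1.exp using 1
    ring
  have h2 := is_const_of_deriv_eq_zero (fun z => (hE z).differentiableAt)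
    (fun z => (hE z).deriv) z 0
  simp only [P_zero_one, intervalIntegral.integral_same, Real.exp_zero, mul_one] at h2
  have h3 := Real.exp_pos (∫ s in (0 : ℝ)..z, IsTrigSolution.pairing ε w s)
  exact pos_of_mul_pos_left (by rw [h2]; exact one_pos) h3.le

theorem hasDerivAt_log_P (hε : ε = 1 ∨ ε = -1) (hw : IsTrigSolution ε w) (ζ : ℝ) :
    HasDerivAt (fun z => Real.log (P ε z 1)) (-IsTrigSolution.pairing ε w ζ) ζ := by
  have hP := P_one_pos hε hw ζ
  convert! (hasDerivAt_P hε hw ζ).log hP.ne' using 1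
  rw [mul_div_cancel_right₀ _ hP.ne']

end Determinant

end SineDet

end

theorem theorem4p5 :
    ∀ ζ : ℝ, 0 < ζ →
      SineDet.IsResolventKernel ζ SineDet.sineKernel (SineDet.Q ζ) ∧
      IntervalIntegrable (fun s : ℝ => SineDet.r s ^ 2) volume 0 ζ ∧
      ∀ ε : ℝ, ε = 1 ∨ ε = -1 →
        Summable (SineDet.fredholmTerm (SineDet.kPM ε ζ) (-1) 1 1) ∧
        0 < SineDet.P ε ζ 1 ∧
        DifferentiableAt ℝ (fun z : ℝ => Real.log (SineDet.P ε z 1)) ζ ∧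
        ζ * deriv (fun z : ℝ => Real.log (SineDet.P ε z 1)) ζ =
          -((∫ s in (0 : ℝ)..ζ, ‖SineDet.r s ^ 2‖) +
            ε * (∫ s in (0 : ℝ)..ζ, SineDet.r s ^ 2).re) := by
  intro ζ hζ
  obtain ⟨w, hw⟩ := SineDet.exists_isTrigSolution (Or.inl rfl)
  obtain ⟨v, hv⟩ := SineDet.exists_isTrigSolution (Or.inr rfl)
  have hw1 : Continuous fun s => w s 1 :=
    hw.1.comp (by fun_prop : Continuous fun s : ℝ => (s, (1 : ℝ)))
  have hv1 : Continuous fun s => v s 1 :=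
    hv.1.comp (by fun_prop : Continuous fun s : ℝ => (s, (1 : ℝ)))
  -- A continuous function that agrees with `r ^ 2` on `(0, ζ]`; the value of `r` at `0`, where the
  -- resolvent statements do not apply, is irrelevant to the integrals.
  let ρ : ℝ → ℂ := fun s => ((w s 1 : ℂ) + (v s 1 : ℂ) * Complex.I) ^ 2
  have hρ : Continuous ρ := by fun_prop
  have hrρ : ∀ s ∈ Ioc 0 ζ, SineDet.r s ^ 2 = ρ s := fun s hs => by
    rw [SineDet.r_eq hw hv hs.1]
  have hint : IntervalIntegrable (fun s : ℝ => SineDet.r s ^ 2) volume 0 ζ := by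
    rw [intervalIntegrable_iff_integrableOn_Ioc_of_le hζ.le]
    exact ((intervalIntegrable_iff_integrableOn_Ioc_of_le hζ.le).1
      (hρ.intervalIntegrable 0 ζ)).congr_fun (fun s hs => (hrρ s hs).symm) measurableSet_Ioc
  have hw2 : IntervalIntegrable (fun s => w s 1 ^ 2) volume 0 ζ :=
    (hw1.pow 2).intervalIntegrable _ _
  have hv2 : IntervalIntegrable (fun s => v s 1 ^ 2) volume 0 ζ :=
    (hv1.pow 2).intervalIntegrable _ _
  have habs : ∫ s in (0 : ℝ)..ζ, ‖SineDet.r s ^ 2‖ =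
      (∫ s in (0 : ℝ)..ζ, w s 1 ^ 2) + ∫ s in (0 : ℝ)..ζ, v s 1 ^ 2 := by
    rw [← intervalIntegral.integral_add hw2 hv2,
      intervalIntegral.integral_of_le hζ.le, intervalIntegral.integral_of_le hζ.le]
    exact setIntegral_congr_fun measurableSet_Ioc fun s hs => SineDet.norm_r_sq hw hv hs.1
  have hre : (∫ s in (0 : ℝ)..ζ, SineDet.r s ^ 2).re =
      (∫ s in (0 : ℝ)..ζ, w s 1 ^ 2) - ∫ s in (0 : ℝ)..ζ, v s 1 ^ 2 := by
    rw [← intervalIntegral.integral_sub hw2 hv2,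
      ← Complex.reCLM_apply, ← Complex.reCLM.intervalIntegral_comp_comm hint,
      intervalIntegral.integral_of_le hζ.le, intervalIntegral.integral_of_le hζ.le]
    refine setIntegral_congr_fun measurableSet_Ioc fun s hs => ?_
    simp only [hrρ s hs, ρ, Complex.reCLM_apply]
    simp [sq]
  refine ⟨SineDet.isResolventKernel_Q hζ, hint, ?_⟩
  have main : ∀ {ε : ℝ} {u : ℝ → ℝ → ℝ}, ε = 1 ∨ ε = -1 → SineDet.IsTrigSolution ε u →
      Summable (SineDet.fredholmTerm (SineDet.kPM ε ζ) (-1) 1 1) ∧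
        0 < SineDet.P ε ζ 1 ∧
        DifferentiableAt ℝ (fun z : ℝ => Real.log (SineDet.P ε z 1)) ζ ∧
        ζ * deriv (fun z : ℝ => Real.log (SineDet.P ε z 1)) ζ =
          -(2 * ∫ s in (0 : ℝ)..ζ, u s 1 ^ 2) := by
    intro ε u hε hu
    have hd := SineDet.hasDerivAt_log_P hε hu ζ
    refine ⟨SineDet.summable_fredholmTerm_kPM hε ζ, SineDet.P_one_pos hε hu ζ,
      hd.differentiableAt, ?_⟩
    rw [hd.deriv, mul_neg, ← hu.integral_boundary_sq hε hζ, intervalIntegral.integral_const_mul]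
  rw [habs, hre]
  rintro ε (rfl | rfl)
  · obtain ⟨h1, h2, h3, h4⟩ := main (Or.inl rfl) hw
    exact ⟨h1, h2, h3, by rw [h4]; ring⟩
  · obtain ⟨h1, h2, h3, h4⟩ := main (Or.inr rfl) hv
    exact ⟨h1, h2, h3, by rw [h4]; ring⟩
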